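/- All graphs are finite and simple. For a graph $G$ with adjacency matrix $A$ and diagonal degree matrix $D$, let $L^+=D+A$ be its signless Laplacian; an eigenvalue of $L^+$ is called a main signless Laplacian eigenvalue of $G$ if it has an eigenvector the sum of whose entries is nonzero. Write $d(v)$ for the degree of $v$ and $s(v)=\sum_{u\sim v}d(u)$. The graph $G$ is called 2-walk $(a,b)$-parabolic if $(a,b)$ is the unique pair of integers with $a>0$, $b\ge 0$, $a^2-8b>0$ and $s(v)=-d(v)^2+a\,d(v)-b$ for all vertices $v$ of $G$. For $k\ge 1$ let $H_k$ be the graph obtained from two vertices joined by three internally disjoint paths, two of length $2$ and one of length $k+1$, by attaching one pendant vertex to each of the $k$ interior vertices of the path of length $k+1$ (for $k=1$: to the interior vertex of exactly one of the three paths of length $2$). **Theorem 1.** Let $G$ be a connected bicyclic graph ($n$ vertices, $n+1$ edges) with minimum degree $\delta(G)=1$. Then $G$ has exactly two main signless Laplacian eigenvalues if and only if $G\cong H_k$ for some $k\ge 1$. Moreover, every $H_k$ with $k\ge 1$ is a 2-walk $(6,2)$-parabolic graph. -/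

import Mathlib

namespace Bicyclic

variable {V : Type*} [Fintype V] [DecidableEq V]

/-- The signless Laplacian matrix `D + A` of a graph, with real entries. -/
def signlessLaplacian (G : SimpleGraph V) [DecidableRel G.Adj] : Matrix V V ℝ :=
  G.degMatrix ℝ + G.adjMatrix ℝ

/-- `μ` is a main signless Laplacian eigenvalue of `G`: it has an eigenvector the sum of whose
entries is not zero (such a vector is automatically nonzero). All eigenvalues are real, since the
matrix is real symmetric. -/
def IsMainEigenvalue (G : SimpleGraph V) [DecidableRel G.Adj] (μ : ℝ) : Prop :=
  ∃ x : V → ℝ, Matrix.mulVec (signlessLaplacian G) x = μ • x ∧ ∑ v, x v ≠ 0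

/-- The graph has exactly two (distinct) main signless Laplacian eigenvalues. -/
def HasExactlyTwoMainEigenvalues (G : SimpleGraph V) [DecidableRel G.Adj] : Prop :=
  {μ : ℝ | IsMainEigenvalue G μ}.encard = 2

/-- A bicyclic graph: connected, with one more edge than vertices. -/
def IsBicyclic (G : SimpleGraph V) [DecidableRel G.Adj] : Prop :=
  G.Connected ∧ G.edgeFinset.card = Fintype.card V + 1

/-- The pair `(a, b)` is admissible for `G`: `a > 0`, `b ≥ 0`, `a² - 8b > 0`, and
`s(v) = -d(v)² + a d(v) - b` for all vertices `v`, where `s(v)` is the sum of the degrees of the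
neighbours of `v`. -/
def SatisfiesParabola (G : SimpleGraph V) [DecidableRel G.Adj] (a b : ℤ) : Prop :=
  0 < a ∧ 0 ≤ b ∧ 0 < a ^ 2 - 8 * b ∧
    ∀ v : V, ∑ u ∈ G.neighborFinset v, (G.degree u : ℤ)
      = -(G.degree v : ℤ) ^ 2 + a * (G.degree v : ℤ) - b

/-- `G` is a 2-walk `(a, b)`-parabolic graph: `(a, b)` is the unique admissible pair for `G`. -/
def IsTwoWalkParabolic (G : SimpleGraph V) [DecidableRel G.Adj] (a b : ℤ) : Prop :=
  SatisfiesParabola G a b ∧ ∀ a' b' : ℤ, SatisfiesParabola G a' b' → a' = a ∧ b' = b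

/-- Vertices of the graph `H k`: the vertices `path 0, …, path (k + 1)` of a path, two further
vertices `side 0`, `side 1`, and `k` pendant vertices. -/
inductive HVertex (k : ℕ) : Type
  | path (i : Fin (k + 2))
  | side (j : Fin 2)
  | pendant (i : Fin k)
  deriving DecidableEq, Fintype

/-- The generating relation of the edges of `H k`: consecutive vertices of the path are joined,
each of the two side vertices is joined to both ends of the path, and the `i`-th pendant vertex is
joined to the `i`-th interior vertex `path (i + 1)` of the path. -/
def HRel (k : ℕ) : HVertex k → HVertex k → Prop
  | .path i, .path j => (i : ℕ) + 1 = (j : ℕ)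
  | .side _, .path i => (i : ℕ) = 0 ∨ (i : ℕ) = k + 1
  | .pendant i, .path j => (j : ℕ) = (i : ℕ) + 1
  | _, _ => False

instance (k : ℕ) : DecidableRel (HRel k) := fun x y => by
  cases x <;> cases y <;> unfold HRel <;> infer_instance

/-- The graph `H k`: two vertices joined by three internally disjoint paths, two of length `2` and
one of length `k + 1`, with one pendant vertex attached at each of the `k` interior vertices of the
latter path. -/
def H (k : ℕ) : SimpleGraph (HVertex k) := SimpleGraph.fromRel (HRel k)

instance (k : ℕ) : DecidableRel (H k).Adj :=
  inferInstanceAs (DecidableRel (SimpleGraph.fromRel (HRel k)).Adj)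

end Bicyclic

namespace Bicyclic
open Matrix

/-! ### Main eigenvalues and the parabolic degree relation -/

section Spectral
variable {V : Type*} [Fintype V] [DecidableEq V] (G : SimpleGraph V) [DecidableRel G.Adj]

/-! Write `Q = D + A`. Then `Q 1 = 2d` and `Q² 1 = 2(d² + s)`. Since `1` is orthogonal to every
eigenvector of a non-main eigenvalue, having only the main eigenvalues `μ, ν` gives `(Q - μ)(Q - ν)
1 = 0`, that is `s = -d² + (μ + ν) d - μν/2`. For a non-regular graph `μ + ν` is a rational
algebraic integer, so the coefficients are integers (`exists_int_parabola`). Conversely, a parabola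
with positive discriminant on a non-regular graph yields exactly two main eigenvalues
(`hasExactlyTwoMainEigenvalues_of_parabola`), and the degrees of `H k` satisfy one.

It remains to find the bicyclic graphs with a pendant vertex on a parabola. Put `e = d - 1`, `P = a
- b - 2`, `c = b`. The relation becomes `∑ e(u) = (1 + e)(P - e) + e c` over the neighbours `u`.
Pendant vertices have weight 0, so they drop out of these sums, and the relation at a pendant vertex
says that its neighbour has weight `P`. Deleting the pendant vertices leaves a core which still has
one more edge than vertices and has minimum degree at least 2 (`parabolicCore_of_parabola`). Hence
the core has either one vertex with four core neighbours or two with three, all others having two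
and weight 1 or `P`.

Few weights are available, so the local equations can be solved by cases.
`ParabolicCore.false_of_card_four` excludes the first type, `ParabolicCore.not_leafy_of_card_three`
shows that the two branch vertices carry no pendants, and `ParabolicCore.classification` leaves only
`P = c = 2`. All core weights are then 1 or 2 and all neighbour sums are 4: both branch vertices are
joined to the same two vertices of degree 2, and the remaining connection between them runs through
vertices of degree 3. `exists_chain` follows it, and connectedness shows that nothing else is
present. -/

theorem signlessLaplacian_mulVec_apply (x : V → ℝ) (v : V) :
    (signlessLaplacian G *ᵥ x) v = G.degree v * x v + ∑ u ∈ G.neighborFinset v, x u := by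
  simp [signlessLaplacian, add_mulVec, SimpleGraph.degMatrix, mulVec_diagonal,
    SimpleGraph.adjMatrix_mulVec_apply]

theorem signlessLaplacian_isSymm : (signlessLaplacian G).IsSymm := by
  unfold signlessLaplacian
  exact (SimpleGraph.isSymm_degMatrix (R := ℝ) G).add (SimpleGraph.isSymm_adjMatrix G)

theorem signlessLaplacian_dotProduct_comm (x y : V → ℝ) :
    (signlessLaplacian G *ᵥ x) ⬝ᵥ y = x ⬝ᵥ (signlessLaplacian G *ᵥ y) := by
  rw [dotProduct_mulVec, ← mulVec_transpose, (signlessLaplacian_isSymm G).eq]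

/-- An eigenvalue of the signless Laplacian is an algebraic integer. -/
theorem isIntegral_of_signlessLaplacian_mulVec {μ : ℝ} {x : V → ℝ} (hx : x ≠ 0)
    (h : signlessLaplacian G *ᵥ x = μ • x) : IsIntegral ℤ μ := by
  set M : Matrix V V ℤ := G.degMatrix ℤ + G.adjMatrix ℤ
  have hM : M.map (Int.castRingHom ℝ) = signlessLaplacian G := by
    ext i j
    simp [M, signlessLaplacian, SimpleGraph.degMatrix, SimpleGraph.adjMatrix_apply, diagonal_apply]
  refine ⟨M.charpoly, M.charpoly_monic, ?_⟩
  have hd : (scalar V μ - signlessLaplacian G).det = 0 := by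
    apply exists_mulVec_eq_zero_iff.mp
    refine ⟨x, hx, ?_⟩
    rw [sub_mulVec, h]
    ext i
    simp
  rw [← hM, ← Matrix.eval_charpoly, charpoly_map] at hd
  simpa [Polynomial.eval_map] using hd

/-- If all the main eigenvalues are among `μ` and `ν`, then `(Q - μ)(Q - ν)` annihilates the
all-ones vector. -/
theorem quadratic_of_main_subset {μ ν : ℝ} (h : ∀ l, IsMainEigenvalue G l → l = μ ∨ l = ν) :
    signlessLaplacian G *ᵥ (signlessLaplacian G *ᵥ 1)
      - (μ + ν) • (signlessLaplacian G *ᵥ 1) + (μ * ν) • (1 : V → ℝ) = 0 := by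
  set Q := signlessLaplacian G with hQ
  have hH : Q.IsHermitian := by
    rw [IsHermitian, conjTranspose_eq_transpose_of_trivial]; exact signlessLaplacian_isSymm G
  set w := Q *ᵥ (Q *ᵥ 1) - (μ + ν) • (Q *ᵥ 1) + (μ * ν) • (1 : V → ℝ) with hw
  -- Paired with an eigenvector for `l`, the vector `w` gives `(l - μ)(l - ν)` times the entry sum:
  -- one factor vanishes when `l` is main, the entry sum vanishes for this eigenvector otherwise.
  have key : ∀ i, (hH.eigenvectorBasis i).ofLp ⬝ᵥ w = 0 := by
    intro i
    set x : V → ℝ := (hH.eigenvectorBasis i).ofLp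
    have hx : Q *ᵥ x = hH.eigenvalues i • x := hH.mulVec_eigenvectorBasis i
    set l := hH.eigenvalues i
    have h1 : ∀ y : V → ℝ, x ⬝ᵥ (Q *ᵥ y) = l * (x ⬝ᵥ y) := by
      intro y
      rw [hQ, ← signlessLaplacian_dotProduct_comm, ← hQ, hx, smul_dotProduct, smul_eq_mul]
    have h2 : x ⬝ᵥ w = (l - μ) * (l - ν) * (x ⬝ᵥ 1) := by
      simp only [hw, dotProduct_add, dotProduct_sub, dotProduct_smul, h1, smul_eq_mul]; ring
    rw [h2]
    by_cases h0 : x ⬝ᵥ 1 = 0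
    · rw [h0, mul_zero]
    · rcases h l ⟨x, hx, by simpa [dotProduct] using h0⟩ with h' | h' <;> simp [h']
  have : WithLp.toLp 2 w = 0 := by
    apply hH.eigenvectorBasis.repr.injective
    ext i
    rw [OrthonormalBasis.repr_apply_apply]
    simpa [PiLp.inner_apply, dotProduct, mul_comm] using key i
  simpa using congrArg WithLp.ofLp this

theorem signlessLaplacian_mulVec_one (v : V) :
    (signlessLaplacian G *ᵥ 1) v = 2 * G.degree v := by
  rw [signlessLaplacian_mulVec_apply]; simp; ring

theorem signlessLaplacian_mulVec_mulVec_one (v : V) :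
    (signlessLaplacian G *ᵥ (signlessLaplacian G *ᵥ 1)) v
      = 2 * ((G.degree v : ℝ) ^ 2 + ∑ u ∈ G.neighborFinset v, (G.degree u : ℝ)) := by
  rw [signlessLaplacian_mulVec_apply]
  simp only [signlessLaplacian_mulVec_one, ← Finset.mul_sum]; ring

/-- A non-regular graph with exactly two main eigenvalues satisfies an integral parabolic
degree relation. -/
theorem exists_int_parabola (h : HasExactlyTwoMainEigenvalues G) {v₀ v₁ : V}
    (hne : G.degree v₀ ≠ G.degree v₁) :
    ∃ a b : ℤ, ∀ v : V, ∑ u ∈ G.neighborFinset v, (G.degree u : ℤ)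
      = -(G.degree v : ℤ) ^ 2 + a * (G.degree v : ℤ) - b := by
  obtain ⟨μ, ν, -, hS⟩ := Set.encard_eq_two.mp h
  have hmain : ∀ l, IsMainEigenvalue G l ↔ l = μ ∨ l = ν := fun l => by
    simpa using Set.ext_iff.mp hS l
  have hint : ∀ l, IsMainEigenvalue G l → IsIntegral ℤ l := by
    rintro l ⟨x, hx, hs⟩
    refine isIntegral_of_signlessLaplacian_mulVec G ?_ hx
    rintro rfl; simp at hs
  have hq := quadratic_of_main_subset G fun l hl => (hmain l).mp hl
  have hv : ∀ v, ∑ u ∈ G.neighborFinset v, (G.degree u : ℝ)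
      = -(G.degree v : ℝ) ^ 2 + (μ + ν) * G.degree v - μ * ν / 2 := by
    intro v
    have := congrFun hq v
    simp only [Pi.add_apply, Pi.sub_apply, Pi.smul_apply, signlessLaplacian_mulVec_one,
      signlessLaplacian_mulVec_mulVec_one, smul_eq_mul, Pi.one_apply, Pi.zero_apply] at this
    linarith
  have hI : IsIntegral ℤ (μ + ν) :=
    (hint μ ((hmain μ).mpr (Or.inl rfl))).add (hint ν ((hmain ν).mpr (Or.inr rfl)))
  set s : V → ℤ := fun v => ∑ u ∈ G.neighborFinset v, (G.degree u : ℤ) with hsdef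
  have hs : ∀ v, (s v : ℝ) = ∑ u ∈ G.neighborFinset v, (G.degree u : ℝ) := by
    intro v; simp [hsdef]
  have hd : (G.degree v₀ : ℝ) - G.degree v₁ ≠ 0 := by
    rw [sub_ne_zero]; exact_mod_cast hne
  -- Subtracting the relations at `v₀` and `v₁` eliminates `μν/2` and exhibits `μ + ν` as a quotient
  -- of integers.
  have hrat : ((((s v₀ + (G.degree v₀ : ℤ) ^ 2 - s v₁ - (G.degree v₁ : ℤ) ^ 2 : ℤ) : ℚ) /
      ((G.degree v₀ : ℚ) - G.degree v₁) : ℚ) : ℝ) = μ + ν := by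
    push_cast
    rw [div_eq_iff hd, hs, hs, hv, hv]; ring
  rw [← hrat] at hI
  have hI' := (isIntegral_algebraMap_iff (R := ℤ) (A := ℚ) (B := ℝ)
    (algebraMap ℚ ℝ).injective).mp hI
  obtain ⟨a, ha⟩ := IsIntegrallyClosed.isIntegral_iff.mp hI'
  have ha' : (a : ℝ) = μ + ν := by
    rw [← hrat, ← ha]; simp
  -- `b` is read off from the relation at `v₀`, so it is visibly an integer.
  refine ⟨a, -s v₀ - (G.degree v₀ : ℤ) ^ 2 + a * G.degree v₀, fun v => ?_⟩
  change s v = _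
  have h3 := hv v₀
  have h4 := hv v
  rw [← hs, ← ha'] at h3 h4
  have : (s v : ℝ) = -(G.degree v : ℝ) ^ 2 + a * G.degree v -
      (-s v₀ - (G.degree v₀ : ℝ) ^ 2 + a * G.degree v₀) := by linarith
  exact_mod_cast this

/-- A non-regular graph satisfying a parabolic degree relation with positive discriminant has
exactly two main eigenvalues. -/
theorem hasExactlyTwoMainEigenvalues_of_parabola {a b : ℤ} (h : SatisfiesParabola G a b)
    {v₀ v₁ : V} (hne : G.degree v₀ ≠ G.degree v₁) : HasExactlyTwoMainEigenvalues G := by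
  obtain ⟨-, -, hdisc, hv⟩ := h
  have hpos : (0 : ℝ) < (a : ℝ) ^ 2 - 8 * b := by exact_mod_cast hdisc
  set r := √((a : ℝ) ^ 2 - 8 * b)
  have hr : r * r = (a : ℝ) ^ 2 - 8 * b := Real.mul_self_sqrt hpos.le
  have hr0 : 0 < r := Real.sqrt_pos.mpr hpos
  set Q := signlessLaplacian G
  have main : ∀ α β : ℝ, α ≠ β → α + β = a → α * β = 2 * b → IsMainEigenvalue G α := by
    intro α β hαβ hsum hprod
    -- Since `(Q - α)(Q - β) 1 = 0`, the vector `(Q - β) 1` is an eigenvector for `α`, provided it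
    -- is nonzero.
    set x : V → ℝ := Q *ᵥ 1 - β • 1 with hx
    have hQx : Q *ᵥ x = α • x := by
      rw [hx, mulVec_sub, mulVec_smul]
      ext v
      have h1 : ∑ u ∈ G.neighborFinset v, (G.degree u : ℝ)
          = -(G.degree v : ℝ) ^ 2 + a * (G.degree v : ℝ) - b := by exact_mod_cast hv v
      simp only [Q, Pi.sub_apply, Pi.smul_apply, signlessLaplacian_mulVec_one,
        signlessLaplacian_mulVec_mulVec_one, smul_eq_mul, Pi.one_apply, h1]
      linear_combination (-2 * G.degree v : ℝ) * hsum + hprod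
    refine ⟨x, hQx, fun hs => hne ?_⟩
    -- If `x ⟂ 1`, then also `x ⟂ Q 1` because `Q` is symmetric and `x` an eigenvector; so `x` is
    -- orthogonal to itself, and `x = 0` would make all degrees equal.
    have h1 : x ⬝ᵥ x = 0 := by
      have e1 : (1 : V → ℝ) ⬝ᵥ x = 0 := by simpa [dotProduct] using hs
      have e2 : (Q *ᵥ 1) ⬝ᵥ x = 0 := by
        rw [signlessLaplacian_dotProduct_comm, hQx, dotProduct_smul, e1, smul_zero]
      nth_rewrite 1 [hx]
      rw [sub_dotProduct, smul_dotProduct, e1, e2]; simp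
    have h2 : x = 0 := dotProduct_self_eq_zero.mp h1
    have h3 : ∀ v, 2 * (G.degree v : ℝ) = β := by
      intro v
      have := congrFun h2 v
      simp only [hx, Q, Pi.sub_apply, Pi.smul_apply, signlessLaplacian_mulVec_one,
        smul_eq_mul, Pi.one_apply, Pi.zero_apply] at this
      linarith
    have h4 := h3 v₀
    rw [← h3 v₁] at h4
    exact_mod_cast mul_left_cancel₀ two_ne_zero h4
  have hset : {μ : ℝ | IsMainEigenvalue G μ} = {(a + r) / 2, (a - r) / 2} := by
    ext μ
    simp only [Set.mem_ofPred_eq, Set.mem_insert_iff, Set.mem_singleton_iff]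
    constructor
    · rintro ⟨x, hx, hs⟩
      have e0 : x ⬝ᵥ 1 ≠ 0 := by simpa [dotProduct] using hs
      have h1 : ∀ y : V → ℝ, x ⬝ᵥ (Q *ᵥ y) = μ * (x ⬝ᵥ y) := by
        intro y
        rw [← signlessLaplacian_dotProduct_comm, hx, smul_dotProduct, smul_eq_mul]
      have hw : Q *ᵥ (Q *ᵥ 1) - (a : ℝ) • (Q *ᵥ 1) + (2 * b : ℝ) • (1 : V → ℝ) = 0 := by
        ext v
        have h1 : ∑ u ∈ G.neighborFinset v, (G.degree u : ℝ)
            = -(G.degree v : ℝ) ^ 2 + a * (G.degree v : ℝ) - b := by exact_mod_cast hv v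
        simp only [Q, Pi.add_apply, Pi.sub_apply, Pi.smul_apply, signlessLaplacian_mulVec_one,
          signlessLaplacian_mulVec_mulVec_one, smul_eq_mul, Pi.one_apply, h1, Pi.zero_apply]
        ring
      have h2 := congrArg (x ⬝ᵥ ·) hw
      simp only [dotProduct_add, dotProduct_sub, dotProduct_smul, h1, smul_eq_mul,
        dotProduct_zero] at h2
      have h3 : (μ - (a + r) / 2) * (μ - (a - r) / 2) * (x ⬝ᵥ 1) = 0 := by
        linear_combination h2 - (x ⬝ᵥ 1) / 4 * hr
      rcases mul_eq_zero.mp ((mul_eq_zero.mp h3).resolve_right e0) with h | h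
      · left; linarith
      · right; linarith
    · rintro (rfl | rfl)
      · exact main _ ((a - r) / 2) (by intro h; linarith) (by ring) (by linear_combination -hr / 4)
      · exact main _ ((a + r) / 2) (by intro h; linarith) (by ring) (by linear_combination -hr / 4)
  rw [HasExactlyTwoMainEigenvalues, hset]
  exact Set.encard_pair (by intro h; linarith)

end Spectral
-- Degrees and neighbourhoods in `H k`
section HFacts
open HVertex

theorem H_adj {k : ℕ} {x y : HVertex k} : (H k).Adj x y ↔ x ≠ y ∧ (HRel k x y ∨ HRel k y x) :=
  SimpleGraph.fromRel_adj _ _ _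

theorem H_neighborFinset_pendant {k : ℕ} (i : Fin k) :
    (H k).neighborFinset (pendant i) = {path i.succ.castSucc} := by
  ext v
  rcases v with j | j | j <;> simp [H_adj, HRel, Fin.ext_iff]

theorem H_neighborFinset_side {k : ℕ} (i : Fin 2) :
    (H k).neighborFinset (side i) = {path 0, path (Fin.last (k + 1))} := by
  ext v
  rcases v with j | j | j <;> simp [H_adj, HRel, Fin.ext_iff, -Fin.val_eq_zero_iff]

theorem H_neighborFinset_path_zero (k : ℕ) :
    (H k).neighborFinset (path 0) = {side 0, side 1, path 1} := by
  ext v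
  rcases v with j | j | j
  · simp [H_adj, HRel, Fin.ext_iff, -Fin.val_eq_zero_iff]; omega
  · simp [H_adj, HRel]; omega
  · simp [H_adj, HRel]

theorem H_neighborFinset_path_last (k : ℕ) :
    (H k).neighborFinset (path (Fin.last (k + 1)))
      = {side 0, side 1, path (Fin.last k).castSucc} := by
  ext v
  rcases v with j | j | j
  · simp [H_adj, HRel, Fin.ext_iff]; omega
  · simp [H_adj, HRel]; omega
  · simp [H_adj, HRel]; omega

theorem H_neighborFinset_path_interior {k : ℕ} (i : Fin k) :
    (H k).neighborFinset (path i.succ.castSucc)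
      = {path i.castSucc.castSucc, path i.succ.succ, pendant i} := by
  ext v
  rcases v with j | j | j
  · simp [H_adj, HRel, Fin.ext_iff]; omega
  · simp [H_adj, HRel]; omega
  · simp [H_adj, HRel, Fin.ext_iff]; omega

theorem fin_path_cases {k : ℕ} (i : Fin (k + 2)) :
    i = 0 ∨ i = Fin.last (k + 1) ∨ ∃ j : Fin k, i = j.succ.castSucc := by
  rcases Nat.eq_zero_or_pos i.val with h | h
  · left; ext; simpa using h
  · by_cases h' : i.val = k + 1
    · right; left; ext; simpa using h'
    · refine Or.inr (Or.inr ⟨⟨i.val - 1, by omega⟩, ?_⟩)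
      ext; simp; omega

theorem H_degree_pendant {k : ℕ} (i : Fin k) : (H k).degree (pendant i) = 1 := by
  rw [← SimpleGraph.card_neighborFinset_eq_degree, H_neighborFinset_pendant]; simp

theorem H_degree_side {k : ℕ} (i : Fin 2) : (H k).degree (side i) = 2 := by
  rw [← SimpleGraph.card_neighborFinset_eq_degree, H_neighborFinset_side]
  exact Finset.card_pair (by simp [Fin.ext_iff])

theorem H_degree_path {k : ℕ} (i : Fin (k + 2)) : (H k).degree (path i) = 3 := by
  rw [← SimpleGraph.card_neighborFinset_eq_degree]
  rcases fin_path_cases i with rfl | rfl | ⟨j, rfl⟩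
  · rw [H_neighborFinset_path_zero]; simp
  · rw [H_neighborFinset_path_last]; simp
  · rw [H_neighborFinset_path_interior, Finset.card_eq_three]
    exact ⟨_, _, _, by simp [Fin.ext_iff]; omega, by simp, by simp, rfl⟩

theorem H_satisfiesParabola (k : ℕ) : SatisfiesParabola (H k) 6 2 := by
  refine ⟨by norm_num, by norm_num, by norm_num, ?_⟩
  rintro (i | i | i)
  · rw [H_degree_path]
    rcases fin_path_cases i with rfl | rfl | ⟨j, rfl⟩
    · rw [H_neighborFinset_path_zero, Finset.sum_insert (by simp), Finset.sum_pair (by simp)]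
      simp [H_degree_side, H_degree_path]
    · rw [H_neighborFinset_path_last, Finset.sum_insert (by simp), Finset.sum_pair (by simp)]
      simp [H_degree_side, H_degree_path]
    · rw [H_neighborFinset_path_interior, Finset.sum_insert (by simp [Fin.ext_iff]; omega),
        Finset.sum_pair (by simp)]
      simp [H_degree_pendant, H_degree_path]
  · rw [H_degree_side, H_neighborFinset_side, Finset.sum_pair (by simp [Fin.ext_iff])]
    simp [H_degree_path]
  · rw [H_degree_pendant, H_neighborFinset_pendant]
    simp [H_degree_path]

/-- Uniqueness: a pendant vertex and a side vertex, of degrees 1 and 2, give two independent linear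
equations for the pair. -/
theorem H_isTwoWalkParabolic {k : ℕ} (hk : 1 ≤ k) : IsTwoWalkParabolic (H k) 6 2 := by
  refine ⟨H_satisfiesParabola k, ?_⟩
  rintro a b ⟨-, -, -, h⟩
  have h1 := h (pendant ⟨0, hk⟩)
  have h2 := h (side 0)
  rw [H_degree_side, H_neighborFinset_side, Finset.sum_pair (by simp [Fin.ext_iff])] at h2
  rw [H_degree_pendant, H_neighborFinset_pendant] at h1
  simp only [H_degree_path, Finset.sum_singleton] at h1 h2
  push_cast at h1 h2
  constructor <;> linarith

theorem SatisfiesParabola.of_iso {V W : Type*} [Fintype V] [DecidableEq V] [Fintype W]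
    [DecidableEq W] {G : SimpleGraph V} {G' : SimpleGraph W} [DecidableRel G.Adj]
    [DecidableRel G'.Adj] (φ : G ≃g G') {a b : ℤ} (h : SatisfiesParabola G' a b) :
    SatisfiesParabola G a b := by
  refine ⟨h.1, h.2.1, h.2.2.1, fun v => ?_⟩
  rw [← φ.degree_eq v, ← h.2.2.2 (φ v)]
  refine Finset.sum_bij (fun u _ => φ u) ?_ ?_ ?_ ?_
  · intro u hu; simpa [φ.map_adj_iff] using hu
  · intro u _ u' _ hh; exact φ.injective hh
  · intro w hw
    refine ⟨φ.symm w, ?_, by simp⟩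
    rw [SimpleGraph.mem_neighborFinset, ← φ.map_adj_iff]
    simpa using hw
  · intro u _; rw [φ.degree_eq]

theorem hasExactlyTwoMainEigenvalues_of_iso_H {V : Type*} [Fintype V] [DecidableEq V]
    (G : SimpleGraph V) [DecidableRel G.Adj] {k : ℕ} (φ : G ≃g H k) :
    HasExactlyTwoMainEigenvalues G := by
  refine hasExactlyTwoMainEigenvalues_of_parabola G ((H_satisfiesParabola k).of_iso φ)
    (v₀ := φ.symm (side 0)) (v₁ := φ.symm (path 0)) ?_
  rw [← φ.degree_eq, ← φ.degree_eq]
  simp [H_degree_side, H_degree_path]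

end HFacts
-- Classification of parabolic cores
section Core
variable {V : Type*}

/-- The combinatorial data of a bicyclic core: a finite set `C` of vertices with neighbourhoods
`N v` inside `C`, and weights `e v` (the degree minus one in the ambient graph) satisfying a
parabolic relation. The leafy vertices are those carrying pendant vertices; all of them have the
same weight `P`. -/
structure ParabolicCore (C : Finset V) (N : V → Finset V) (e : V → ℤ) (P c : ℤ)
    (leafy : V → Prop) : Prop where
  mem : ∀ v ∈ C, ∀ u ∈ N v, u ∈ C
  symm : ∀ v ∈ C, ∀ u ∈ N v, v ∈ N u
  irrefl : ∀ v, v ∉ N v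
  sum_eq : ∀ v ∈ C, ∑ u ∈ N v, e u = (1 + e v) * (P - e v) + e v * c
  two_le : ∀ v ∈ C, 2 ≤ (N v).card
  total : ∑ v ∈ C, ((N v).card - 2) = 2
  weight_leafy : ∀ v ∈ C, leafy v → e v = P ∧ ((N v).card : ℤ) ≤ P
  weight_nonleafy : ∀ v ∈ C, ¬ leafy v → e v = (N v).card - 1
  exists_leafy : ∃ v ∈ C, leafy v

theorem sum_eq_two_cases {ι : Type*} [DecidableEq ι] {C : Finset ι} {f : ι → ℕ}
    (h : ∑ v ∈ C, f v = 2) :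
    (∃ x ∈ C, f x = 2 ∧ ∀ v ∈ C, v ≠ x → f v = 0) ∨
    (∃ x ∈ C, ∃ y ∈ C, x ≠ y ∧ f x = 1 ∧ f y = 1 ∧ ∀ v ∈ C, v ≠ x → v ≠ y → f v = 0) := by
  obtain ⟨x, hx, hfx⟩ : ∃ x ∈ C, f x ≠ 0 := by
    by_contra! hcon
    rw [Finset.sum_eq_zero hcon] at h; omega
  have h1 := Finset.add_sum_erase C f hx
  have hle : f x = 1 ∨ f x = 2 := by omega
  rcases hle with h2 | h2
  · right
    have h3 : ∑ v ∈ C.erase x, f v = 1 := by omega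
    obtain ⟨y, hy, hfy⟩ : ∃ y ∈ C.erase x, f y ≠ 0 := by
      by_contra! hcon
      rw [Finset.sum_eq_zero hcon] at h3; omega
    have h4 := Finset.add_sum_erase _ f hy
    have h5 : ∑ v ∈ (C.erase x).erase y, f v = 0 := by omega
    have h6 := Finset.sum_eq_zero_iff.mp h5
    refine ⟨x, hx, y, (Finset.mem_erase.mp hy).2, ((Finset.mem_erase.mp hy).1).symm, h2,
      by omega, fun v hv hvx hvy => h6 v ?_⟩
    simp [hv, hvx, hvy]
  · left
    have h3 : ∑ v ∈ C.erase x, f v = 0 := by omega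
    exact ⟨x, hx, h2, fun v hv hvx => Finset.sum_eq_zero_iff.mp h3 v (by simp [hv, hvx])⟩

/-- Applied to a leafy vertex with two core neighbours: its weight is `P`, so their weights sum to
`P * c`. -/
theorem eq_one_or_two_of_mul_lt {P c s : ℤ} (hP : 2 ≤ P) (h : s = P * c) (h0 : 0 < s)
    (h3 : s < 3 * P) : c = 1 ∨ c = 2 := by
  have h1 : 0 < c := by
    by_contra! hc
    nlinarith
  have h2 : c < 3 := by
    by_contra! hc
    nlinarith
  omega

namespace ParabolicCore
variable {C : Finset V} {N : V → Finset V} {e : V → ℤ} {P c : ℤ} {leafy : V → Prop}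
  (h : ParabolicCore C N e P c leafy)
include h

theorem two_le_P : 2 ≤ P := by
  obtain ⟨v, hv, hl⟩ := h.exists_leafy
  have h1 := h.two_le v hv
  have h2 := (h.weight_leafy v hv hl).2
  omega

theorem ne_of_mem {u v : V} (hu : u ∈ N v) : u ≠ v := by
  rintro rfl; exact h.irrefl _ hu

/-- The weight of a vertex with two core neighbours. -/
theorem weight_of_card_two {v : V} (hv : v ∈ C) (h2 : (N v).card = 2) : e v = 1 ∨ e v = P := by
  by_cases hl : leafy v
  · exact Or.inr (h.weight_leafy v hv hl).1
  · left; rw [h.weight_nonleafy v hv hl, h2]; norm_num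

variable [DecidableEq V]

theorem other_neighbor {u v : V} (hv : v ∈ C) (h2 : (N v).card = 2) (hu : u ∈ N v) :
    ∃ u' ∈ C, u' ≠ u ∧ N v = {u, u'} ∧ e u + e u' = (1 + e v) * (P - e v) + e v * c := by
  obtain ⟨a, b, hab, hN⟩ := Finset.card_eq_two.mp h2
  have hs := h.sum_eq v hv
  have hm := h.mem v hv
  rw [hN] at hu hs hm
  rw [Finset.sum_pair hab] at hs
  rcases Finset.mem_insert.mp hu with rfl | hu
  · exact ⟨b, hm b (by simp), hab.symm, hN, hs⟩
  · rw [Finset.mem_singleton.mp hu]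
    exact ⟨a, hm a (by simp), hab, by rw [hN, Finset.pair_comm], by rw [← hs, add_comm]⟩

theorem three_neighbors {v : V} (hv : v ∈ C) (h3 : (N v).card = 3) :
    ∃ p q r, p ≠ q ∧ p ≠ r ∧ q ≠ r ∧ N v = {p, q, r} ∧
      e p + e q + e r = (1 + e v) * (P - e v) + e v * c := by
  obtain ⟨p, q, r, h1, h2, h4, hN⟩ := Finset.card_eq_three.mp h3
  refine ⟨p, q, r, h1, h2, h4, hN, ?_⟩
  rw [← h.sum_eq v hv, hN, Finset.sum_insert (by simp [h1, h2]), Finset.sum_pair h4, add_assoc]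

theorem four_neighbors {v : V} (hv : v ∈ C) (h3 : (N v).card = 4) :
    ∃ p q r s, p ≠ q ∧ p ≠ r ∧ p ≠ s ∧ q ≠ r ∧ q ≠ s ∧ r ≠ s ∧ N v = {p, q, r, s} ∧
      e p + e q + e r + e s = (1 + e v) * (P - e v) + e v * c := by
  obtain ⟨p, t, hp, ht, h3'⟩ := Finset.card_eq_succ.mp h3
  obtain ⟨q, r, s, h1, h2, h4, rfl⟩ := Finset.card_eq_three.mp h3'
  simp only [Finset.mem_insert, Finset.mem_singleton, not_or] at hp
  refine ⟨p, q, r, s, hp.1, hp.2.1, hp.2.2, h1, h2, h4, ht.symm, ?_⟩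
  rw [← h.sum_eq v hv, ← ht, Finset.sum_insert (by simp [hp]), Finset.sum_insert (by simp [h1, h2]),
    Finset.sum_pair h4]
  ring

/-- No core vertex has four core neighbours. -/
theorem false_of_card_four {x : V} (hx : x ∈ C) (hx4 : (N x).card = 4)
    (ho : ∀ v ∈ C, v ≠ x → (N v).card = 2) : False := by
  have hP := h.two_le_P
  have hE : ∀ v ∈ C, v ≠ x → e v = 1 ∨ e v = P := fun v hv hvx =>
    h.weight_of_card_two hv (ho v hv hvx)
  have hNE : ∀ v ∈ N x, e v = 1 ∨ e v = P := fun v hv => hE v (h.mem x hx v hv) (h.ne_of_mem hv)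
  have hNo : ∀ u ∈ N x, ∃ u' ∈ C, u' ≠ x ∧ N u = {x, u'} ∧
      e x + e u' = (1 + e u) * (P - e u) + e u * c := fun u hu =>
    h.other_neighbor (h.mem x hx u hu) (ho u (h.mem x hx u hu) (h.ne_of_mem hu))
      (h.symm x hx u hu)
  obtain ⟨p, q, r, s, hpq, hpr, hps, hqr, hqs, hrs, hN, hsum⟩ := h.four_neighbors hx hx4
  have hp : p ∈ N x := by simp [hN]
  have hq : q ∈ N x := by simp [hN]
  have hr : r ∈ N x := by simp [hN]
  have hs : s ∈ N x := by simp [hN]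
  have kp := hNE p hp
  have kq := hNE q hq
  have kr := hNE r hr
  have ks := hNE s hs
  -- The two ways to proceed: a neighbour of weight 1 determines the weight behind it, and otherwise
  -- all four weights are `P`.
  have hex : (∃ u ∈ N x, e u = 1) ∨ (e p = P ∧ e q = P ∧ e r = P ∧ e s = P) := by
    rcases kp with kp | kp
    · exact Or.inl ⟨p, hp, kp⟩
    rcases kq with kq | kq
    · exact Or.inl ⟨q, hq, kq⟩
    rcases kr with kr | kr
    · exact Or.inl ⟨r, hr, kr⟩
    rcases ks with ks | ks
    · exact Or.inl ⟨s, hs, ks⟩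
    exact Or.inr ⟨kp, kq, kr, ks⟩
  by_cases hl : leafy x
  · obtain ⟨ex, hP4⟩ := h.weight_leafy x hx hl
    rw [hx4] at hP4
    push_cast at hP4
    rw [ex] at hsum
    have hc : 0 < c := by
      by_contra! hc
      have : P * c ≤ 0 := by nlinarith
      rcases kp with kp | kp <;> rcases kq with kq | kq <;> rcases kr with kr | kr <;>
        rcases ks with ks | ks <;> nlinarith
    rcases hex with ⟨u, hu, eu⟩ | ⟨kp, kq, kr, ks⟩
    · obtain ⟨u', hu', hne, -, hs'⟩ := hNo u hu
      rw [ex, eu] at hs'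
      have hc2 : c = 2 := by
        rcases hE u' hu' hne with h1 | h1 <;> omega
      subst hc2
      ring_nf at hsum
      omega
    · have hc4 : c = 4 := by
        have : P * (c - 4) = 0 := by linarith
        rcases mul_eq_zero.mp this with h1 | h1 <;> omega
      subst hc4
      obtain ⟨u', hu', hne, -, hs'⟩ := hNo p hp
      rw [ex, kp] at hs'
      ring_nf at hs'
      rcases hE u' hu' hne with h1 | h1 <;> omega
  · have ex := h.weight_nonleafy x hx hl
    rw [hx4] at ex
    norm_num at ex
    rw [ex] at hsum
    have hE' : ∀ v ∈ C, e v = 1 ∨ e v = P ∨ (v = x ∧ e v = 3) := by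
      intro v hv
      by_cases hvx : v = x
      · right; right; exact ⟨hvx, by rw [hvx, ex]⟩
      · rcases hE v hv hvx with h1 | h1 <;> simp [h1]
    obtain ⟨w, hw, hwl⟩ := h.exists_leafy
    have hwx : w ≠ x := by rintro rfl; exact hl hwl
    obtain ⟨w₁, w₂, hw12, hNw⟩ := Finset.card_eq_two.mp (ho w hw hwx)
    have hsw := h.sum_eq w hw
    have hw1 : w₁ ∈ C := h.mem w hw _ (by simp [hNw])
    have hw2 : w₂ ∈ C := h.mem w hw _ (by simp [hNw])
    rw [(h.weight_leafy w hw hwl).1, hNw, Finset.sum_pair hw12] at hsw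
    have hsw' : e w₁ + e w₂ = P * c := by linarith
    -- Only one of the two neighbours can be `x`; without this, `3 + 3` would break the strict bound
    -- `3 * P` when `P = 2`.
    have hnot : ¬ ((w₁ = x ∧ e w₁ = 3) ∧ (w₂ = x ∧ e w₂ = 3)) := by
      rintro ⟨⟨h1, -⟩, ⟨h2, -⟩⟩; exact hw12 (h1.trans h2.symm)
    have hc : c = 1 ∨ c = 2 := by
      apply eq_one_or_two_of_mul_lt hP hsw'
      · rcases hE' w₁ hw1 with h1 | h1 | h1 <;> rcases hE' w₂ hw2 with h2 | h2 | h2 <;> omega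
      · rcases hE' w₁ hw1 with h1 | h1 | h1 <;> rcases hE' w₂ hw2 with h2 | h2 | h2 <;>
          first | omega | exact absurd ⟨h1, h2⟩ hnot
    rcases hc with rfl | rfl
    · clear hex
      have hP4 : P = 4 := by
        rcases hE' w₁ hw1 with h1 | h1 | h1 <;> rcases hE' w₂ hw2 with h2 | h2 | h2 <;>
          omega
      subst hP4
      norm_num at hsum
      -- Now the weights around `x` sum to 7, so they are 1, 1, 1, 4. Each neighbour of weight 1
      -- closes a triangle with `x` and a neighbour of weight 4; but there is only one such
      -- neighbour, and it has room for only one triangle.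
      have claim : ∀ u ∈ N x, e u = 1 → ∃ u' ∈ N x, e u' = 4 ∧ N u' = {u, x} := by
        intro u hu eu
        obtain ⟨u', hu', hne, hNu, hs'⟩ := hNo u hu
        rw [ex, eu] at hs'
        have eu' : e u' = 4 := by omega
        have huu' : u ∈ N u' := h.symm u (h.mem x hx u hu) u' (by simp [hNu])
        obtain ⟨u'', hu'', -, hNu', hs''⟩ := h.other_neighbor hu' (ho u' hu' hne) huu'
        rw [eu', eu] at hs''
        have hx'' : u'' = x := by
          rcases hE' u'' hu'' with h1 | h1 | h1
          · omega
          · omega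
          · exact h1.1
        subst hx''
        exact ⟨u', h.symm u' hu' _ (by simp [hNu']), eu', hNu'⟩
      have fin : ∀ a b d, a ≠ b → a ∈ N x → b ∈ N x → e a = 1 → e b = 1 →
          (∀ z ∈ N x, e z = 4 → z = d) → False := by
        intro a b d hab ha hb ea eb hz
        obtain ⟨a', ha', ea', hNa⟩ := claim a ha ea
        obtain ⟨b', hb', eb', hNb⟩ := claim b hb eb
        rw [hz a' ha' ea'] at hNa
        rw [hz b' hb' eb'] at hNb
        have : a ∈ ({b, x} : Finset V) := by rw [← hNb, hNa]; simp
        rcases Finset.mem_insert.mp this with h1 | h1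
        · exact hab h1
        · exact h.ne_of_mem ha (Finset.mem_singleton.mp h1)
      have hall : ∀ z ∈ N x, z = p ∨ z = q ∨ z = r ∨ z = s := by
        intro z hz; simpa [hN] using hz
      rcases kp with kp | kp
      · rcases kq with kq | kq
        · rcases kr with kr | kr
          · refine fin p q s hpq hp hq kp kq fun z hz ez => ?_
            rcases hall z hz with rfl | rfl | rfl | rfl <;> first | rfl | omega
          · refine fin p q r hpq hp hq kp kq fun z hz ez => ?_
            rcases hall z hz with rfl | rfl | rfl | rfl <;> first | rfl | omega
        · refine fin p r q hpr hp hr kp (by omega) fun z hz ez => ?_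
          rcases hall z hz with rfl | rfl | rfl | rfl <;> first | rfl | omega
      · refine fin q r p hqr hq hr (by omega) (by omega) fun z hz ez => ?_
        rcases hall z hz with rfl | rfl | rfl | rfl <;> first | rfl | omega
    · rcases hex with ⟨u, hu, eu⟩ | ⟨kp, kq, kr, ks⟩
      · obtain ⟨u', hu', hne, hNu, hs'⟩ := hNo u hu
        rw [ex, eu] at hs'
        have eu' := hE u' hu' hne
        have hP3 : P = 3 := by omega
        subst hP3
        have huu' : u ∈ N u' := h.symm u (h.mem x hx u hu) u' (by simp [hNu])
        obtain ⟨u'', hu'', -, hNu', hs''⟩ := h.other_neighbor hu' (ho u' hu' hne) huu'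
        rw [eu, show e u' = 3 by omega] at hs''
        have := hE' u'' hu''
        omega
      · omega

/-- If two core vertices have three core neighbours, neither is leafy. -/
theorem not_leafy_of_card_three {x y : V} (hx : x ∈ C) (hy : y ∈ C) (hxy : x ≠ y)
    (hx3 : (N x).card = 3) (hy3 : (N y).card = 3)
    (ho : ∀ v ∈ C, v ≠ x → v ≠ y → (N v).card = 2) : ¬ leafy x := by
  intro hl
  have hP := h.two_le_P
  obtain ⟨ex, hP3⟩ := h.weight_leafy x hx hl
  rw [hx3] at hP3
  push_cast at hP3
  have hE : ∀ v ∈ C, e v = 1 ∨ e v = P ∨ (v = y ∧ e v = 2) := by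
    intro v hv
    by_cases hvx : v = x
    · right; left; rw [hvx, ex]
    by_cases hvy : v = y
    · by_cases hly : leafy y
      · right; left; rw [hvy, (h.weight_leafy y hy hly).1]
      · right; right
        refine ⟨hvy, ?_⟩
        rw [hvy, h.weight_nonleafy y hy hly, hy3]; norm_num
    · rcases h.weight_of_card_two hv (ho v hv hvx hvy) with h1 | h1 <;> simp [h1]
  have hy1 : e y ≠ 1 := by
    by_cases hly : leafy y
    · rw [(h.weight_leafy y hy hly).1]; omega
    · rw [h.weight_nonleafy y hy hly, hy3]; norm_num
  have hNo : ∀ u ∈ N x, u ≠ y → ∃ u' ∈ C, u' ≠ x ∧ N u = {x, u'} ∧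
      e x + e u' = (1 + e u) * (P - e u) + e u * c := fun u hu huy =>
    h.other_neighbor (h.mem x hx u hu) (ho u (h.mem x hx u hu) (h.ne_of_mem hu) huy)
      (h.symm x hx u hu)
  obtain ⟨p, q, r, hpq, hpr, hqr, hN, hsum⟩ := h.three_neighbors hx hx3
  have hp : p ∈ N x := by simp [hN]
  have hq : q ∈ N x := by simp [hN]
  have hr : r ∈ N x := by simp [hN]
  have kp := hE p (h.mem x hx p hp)
  have kq := hE q (h.mem x hx q hq)
  have kr := hE r (h.mem x hx r hr)
  have hn1 : ¬ (p = y ∧ q = y) := fun hh => hpq (hh.1.trans hh.2.symm)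
  have hn2 : ¬ (p = y ∧ r = y) := fun hh => hpr (hh.1.trans hh.2.symm)
  have hn3 : ¬ (q = y ∧ r = y) := fun hh => hqr (hh.1.trans hh.2.symm)
  rw [ex] at hsum
  have hsum' : e p + e q + e r = P * c := by linarith
  have hy2 : ∀ v, (e v = 1 ∨ e v = P ∨ (v = y ∧ e v = 2)) → e v = 2 → v = y := by
    rintro v (h1 | h1 | h1) h2
    · omega
    · omega
    · exact h1.1
  have hm1 : ¬ (e p = 2 ∧ e q = 2) := fun hh => hn1 ⟨hy2 p kp hh.1, hy2 q kq hh.2⟩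
  have hm2 : ¬ (e p = 2 ∧ e r = 2) := fun hh => hn2 ⟨hy2 p kp hh.1, hy2 r kr hh.2⟩
  have hm3 : ¬ (e q = 2 ∧ e r = 2) := fun hh => hn3 ⟨hy2 q kq hh.1, hy2 r kr hh.2⟩
  have hc0 : 0 < c := by
    by_contra! hc
    have : P * c ≤ 0 := by nlinarith
    omega
  have hc3 : c ≤ 3 := by
    by_contra! hc
    have : P * 4 ≤ P * c := by nlinarith
    omega
  by_cases hc : c = 3
  -- For `c = 3`, the vertex behind a neighbour `z ≠ y` would have weight `P + 1` or `2P`, which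
  -- does not occur.
  · subst hc
    obtain ⟨z, hz, hzy⟩ : ∃ z ∈ N x, z ≠ y := by
      by_cases hpy : p = y
      · exact ⟨q, hq, fun hh => hn1 ⟨hpy, hh⟩⟩
      · exact ⟨p, hp, hpy⟩
    obtain ⟨z', hz', -, -, hs⟩ := hNo z hz hzy
    have ez' := hE z' hz'
    rcases hE z (h.mem x hx z hz) with ez | ez | ez
    · rw [ez, ex] at hs; omega
    · rw [ez, ex] at hs; ring_nf at hs; omega
    · exact hzy ez.1
  have hc12 : c = 1 ∨ c = 2 := by omega
  obtain ⟨u, hu, eu⟩ : ∃ u ∈ N x, e u = 1 := by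
    by_contra! hcon
    have h1 := hcon p hp
    have h2 := hcon q hq
    have h3 := hcon r hr
    rcases hc12 with rfl | rfl <;> omega
  have huy : ∀ u ∈ N x, e u = 1 → u ≠ y := by
    rintro u - eu rfl; exact hy1 eu
  rcases hc12 with rfl | rfl
  · have hP3' : P = 3 := by
      obtain ⟨u', hu', -, -, hs⟩ := hNo u hu (huy u hu eu)
      rw [ex, eu] at hs
      have := hE u' hu'
      omega
    subst hP3'
    have hall : ∀ z ∈ N x, e z = 1 := by
      intro z hz
      rw [hN] at hz
      simp only [Finset.mem_insert, Finset.mem_singleton] at hz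
      rcases hz with rfl | rfl | rfl <;> omega
    -- Behind each neighbour of `x` lies a vertex of weight 2, which can only be `y`. So `N x = N
    -- y`, and the two neighbour sums would be 3 and 5.
    have hsub : N x ⊆ N y := by
      intro z hz
      obtain ⟨z', hz', -, hNz, hs⟩ := hNo z hz (huy z hz (hall z hz))
      rw [ex, hall z hz] at hs
      have : z' = y := by
        rcases hE z' hz' with h1 | h1 | h1
        · omega
        · omega
        · exact h1.1
      subst this
      exact h.symm z (h.mem x hx z hz) _ (by simp [hNz])
    have hNN : N x = N y := Finset.eq_of_subset_of_card_le hsub (by omega)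
    have hsy := h.sum_eq y hy
    rw [← hNN, h.sum_eq x hx, ex] at hsy
    rcases hE y hy with h1 | h1 | h1
    · exact hy1 h1
    · obtain ⟨z', hz', -, hNz, hs⟩ := hNo u hu (huy u hu eu)
      rw [ex, eu] at hs
      have : z' = y ∧ e z' = 2 := by
        rcases hE z' hz' with h1 | h1 | h1
        · omega
        · omega
        · exact h1
      rw [this.1] at this
      omega
    · rw [h1.2] at hsy; norm_num at hsy
  -- The weights around `x` must be 1, 2, `P` with sum `2P`; the 2 belongs to `y`.
  · have hyx : y ∈ N x ∧ e y = 2 ∧ P = 3 := by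
      have hP3 : P = 3 := by omega
      by_cases p2 : e p = 2
      · have := hy2 p kp p2; subst this; exact ⟨hp, p2, hP3⟩
      by_cases q2 : e q = 2
      · have := hy2 q kq q2; subst this; exact ⟨hq, q2, hP3⟩
      have r2 : e r = 2 := by omega
      have := hy2 r kr r2
      subst this
      exact ⟨hr, r2, hP3⟩
    obtain ⟨hyx, ey, rfl⟩ := hyx
    have hxNy : x ∈ N y := h.symm x hx y hyx
    -- The weights around `y` sum to 7, hence are 3, 3, 1, and one 3 is not at `x`. The vertex
    -- behind it would need weight 4.
    obtain ⟨z, hz, hzx, ez⟩ : ∃ z ∈ N y, z ≠ x ∧ e z = 3 := by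
      obtain ⟨p', q', r', hpq', hpr', hqr', hN', hsum'⟩ := h.three_neighbors hy hy3
      rw [ey] at hsum'
      have hp' : p' ∈ N y := by simp [hN']
      have hq' : q' ∈ N y := by simp [hN']
      have hr' : r' ∈ N y := by simp [hN']
      have hE2 : ∀ v ∈ N y, e v = 1 ∨ e v = 3 := by
        intro v hv
        rcases hE v (h.mem y hy v hv) with h1 | h1 | h1
        · exact Or.inl h1
        · exact Or.inr h1
        · exact absurd h1.1 (h.ne_of_mem hv)
      have h1 := hE2 p' hp'
      have h2 := hE2 q' hq'
      have h3 := hE2 r' hr'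
      by_cases e1 : e p' = 3
      · by_cases e2 : e q' = 3
        · by_cases hpx : p' = x
          · exact ⟨q', hq', fun hh => hpq' (hpx.trans hh.symm), e2⟩
          · exact ⟨p', hp', hpx, e1⟩
        · have e3 : e r' = 3 := by omega
          by_cases hpx : p' = x
          · exact ⟨r', hr', fun hh => hpr' (hpx.trans hh.symm), e3⟩
          · exact ⟨p', hp', hpx, e1⟩
      · have e2 : e q' = 3 := by omega
        have e3 : e r' = 3 := by omega
        by_cases hpx : q' = x
        · exact ⟨r', hr', fun hh => hqr' (hpx.trans hh.symm), e3⟩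
        · exact ⟨q', hq', hpx, e2⟩
    have hzC := h.mem y hy z hz
    obtain ⟨z', hz', -, -, hs⟩ := h.other_neighbor hzC
      (ho z hzC hzx (h.ne_of_mem hz)) (h.symm y hy z hz)
    rw [ez, ey] at hs
    have := hE z' hz'
    omega

/-- Double counting: summing the neighbour sums over the core counts each `e u` once per core
neighbour of `u`. -/
theorem sum_weight_balance : ∑ v ∈ C, ((1 + e v) * (P - e v) + e v * c - (N v).card * e v) = 0 := by
  rw [Finset.sum_sub_distrib, sub_eq_zero, ← Finset.sum_congr rfl h.sum_eq]
  have h1 : ∀ v ∈ C, ∑ u ∈ N v, e u = ∑ u ∈ C, if u ∈ N v then e u else 0 := by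
    intro v hv
    rw [← Finset.sum_filter]
    congr 1
    ext u
    simp only [Finset.mem_filter]
    exact ⟨fun hu => ⟨h.mem v hv u hu, hu⟩, fun hu => hu.2⟩
  rw [Finset.sum_congr rfl h1, Finset.sum_comm]
  refine Finset.sum_congr rfl fun u hu => ?_
  rw [← Finset.sum_filter, Finset.sum_const, nsmul_eq_mul]
  congr 3
  ext v
  simp only [Finset.mem_filter]
  exact ⟨fun hv => h.symm v hv.1 u hv.2, fun hv => ⟨h.mem u hu v hv, h.symm u hu v hv⟩⟩

/-- The classification of parabolic cores. -/
theorem classification : P = 2 ∧ c = 2 ∧ ∃ x ∈ C, ∃ y ∈ C, ∃ u₁ ∈ C, ∃ u₂ ∈ C, ∃ z ∈ C, ∃ z' ∈ C,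
    x ≠ y ∧ u₁ ≠ u₂ ∧ e x = 2 ∧ e y = 2 ∧ e u₁ = 1 ∧ e u₂ = 1 ∧ e z = 2 ∧ e z' = 2 ∧
    N x = {u₁, u₂, z} ∧ N y = {u₁, u₂, z'} ∧ N u₁ = {x, y} ∧ N u₂ = {x, y} ∧
    ∀ v ∈ C, e v = 2 → v ≠ x → v ≠ y → (N v).card = 2 ∧ ∀ u ∈ N v, e u = 2 := by
  have hP := h.two_le_P
  rcases sum_eq_two_cases h.total with ⟨x, hx, hx4, ho⟩ | ⟨x, hx, y, hy, hxy, hx3, hy3, ho⟩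
  · exact (h.false_of_card_four hx (by omega) fun v hv hvx => by
      have := ho v hv hvx
      have := h.two_le v hv
      omega).elim
  have hx3 : (N x).card = 3 := by omega
  have hy3 : (N y).card = 3 := by omega
  have ho : ∀ v ∈ C, v ≠ x → v ≠ y → (N v).card = 2 := fun v hv hvx hvy => by
    have := ho v hv hvx hvy
    have := h.two_le v hv
    omega
  have hlx := h.not_leafy_of_card_three hx hy hxy hx3 hy3 ho
  have hly := h.not_leafy_of_card_three hy hx hxy.symm hy3 hx3 fun v hv h1 h2 => ho v hv h2 h1
  have ex : e x = 2 := by rw [h.weight_nonleafy x hx hlx, hx3]; norm_num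
  have ey : e y = 2 := by rw [h.weight_nonleafy y hy hly, hy3]; norm_num
  have hE : ∀ v ∈ C, v ≠ x → v ≠ y → e v = 1 ∨ e v = P := fun v hv hvx hvy =>
    h.weight_of_card_two hv (ho v hv hvx hvy)
  have hE' : ∀ v ∈ C, e v = 1 ∨ e v = P ∨ e v = 2 := by
    intro v hv
    by_cases hvx : v = x
    · simp [hvx, ex]
    by_cases hvy : v = y
    · simp [hvy, ey]
    rcases hE v hv hvx hvy with h1 | h1 <;> simp [h1]
  obtain ⟨w, hw, hwl⟩ := h.exists_leafy
  have hwx : w ≠ x := by rintro rfl; exact hlx hwl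
  have hwy : w ≠ y := by rintro rfl; exact hly hwl
  obtain ⟨w₁, w₂, hw12, hNw⟩ := Finset.card_eq_two.mp (ho w hw hwx hwy)
  have hsw := h.sum_eq w hw
  have hw1 := hE' w₁ (h.mem w hw _ (by simp [hNw]))
  have hw2 := hE' w₂ (h.mem w hw _ (by simp [hNw]))
  rw [(h.weight_leafy w hw hwl).1, hNw, Finset.sum_pair hw12] at hsw
  have hsw' : e w₁ + e w₂ = P * c := by linarith
  have hc : c = 1 ∨ c = 2 :=
    eq_one_or_two_of_mul_lt hP hsw' (by omega) (by omega)
  obtain ⟨p, q, r, hpq, hpr, hqr, hN, hsum⟩ := h.three_neighbors hx hx3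
  have hp : p ∈ N x := by simp [hN]
  have hq : q ∈ N x := by simp [hN]
  have hr : r ∈ N x := by simp [hN]
  have hNE : ∀ v ∈ N x, e v = 1 ∨ e v = P ∨ (v = y ∧ e v = 2) := by
    intro v hv
    by_cases hvy : v = y
    · simp [hvy, ey]
    rcases hE v (h.mem x hx v hv) (h.ne_of_mem hv) hvy with h1 | h1 <;> simp [h1]
  have kp := hNE p hp
  have kq := hNE q hq
  have kr := hNE r hr
  have hn1 : ¬ (p = y ∧ q = y) := fun hh => hpq (hh.1.trans hh.2.symm)
  have hn2 : ¬ (p = y ∧ r = y) := fun hh => hpr (hh.1.trans hh.2.symm)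
  have hn3 : ¬ (q = y ∧ r = y) := fun hh => hqr (hh.1.trans hh.2.symm)
  rw [ex] at hsum
  rcases hc with rfl | rfl
  · exfalso
    have hy2 : ∀ v, (e v = 1 ∨ e v = P ∨ (v = y ∧ e v = 2)) → P ≠ 2 → e v = 2 → v = y := by
      rintro v (h1 | h1 | h1) hP2 h2
      · omega
      · omega
      · exact h1.1
    have hm1 : P ≠ 2 → ¬ (e p = 2 ∧ e q = 2) := fun hP2 hh =>
      hn1 ⟨hy2 p kp hP2 hh.1, hy2 q kq hP2 hh.2⟩
    have hm2 : P ≠ 2 → ¬ (e p = 2 ∧ e r = 2) := fun hP2 hh =>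
      hn2 ⟨hy2 p kp hP2 hh.1, hy2 r kr hP2 hh.2⟩
    have hm3 : P ≠ 2 → ¬ (e q = 2 ∧ e r = 2) := fun hP2 hh =>
      hn3 ⟨hy2 q kq hP2 hh.1, hy2 r kr hP2 hh.2⟩
    have hP' : P = 3 := by omega
    subst hP'
    have hs := h.sum_weight_balance
    rw [← Finset.add_sum_erase C _ hx, ← Finset.add_sum_erase (C.erase x) _
      (Finset.mem_erase.mpr ⟨hxy.symm, hy⟩), ex, ey, hx3, hy3] at hs
    -- With `P = 3`, `c = 1`, a vertex with two core neighbours contributes 3 or -3 to the balance,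
    -- while `x` and `y` contribute -1 each; the total cannot be 0.
    have hd : (3 : ℤ) ∣ ∑ v ∈ (C.erase x).erase y,
        ((1 + e v) * (3 - e v) + e v * 1 - (N v).card * e v) := by
      refine Finset.dvd_sum fun v hv => ?_
      simp only [Finset.mem_erase] at hv
      rw [ho v hv.2.2 hv.2.1 hv.1]
      rcases hE v hv.2.2 hv.2.1 hv.1 with h1 | h1 <;> rw [h1] <;> norm_num
    omega
  · have hNo : ∀ u ∈ N x, u ≠ y → ∃ u' ∈ C, u' ≠ x ∧ N u = {x, u'} ∧
        e x + e u' = (1 + e u) * (P - e u) + e u * 2 := fun u hu huy =>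
      h.other_neighbor (h.mem x hx u hu) (ho u (h.mem x hx u hu) (h.ne_of_mem hu) huy)
        (h.symm x hx u hu)
    have hP2 : P = 2 := by
      obtain ⟨z, hz, hzy⟩ : ∃ z ∈ N x, z ≠ y := by
        by_cases hpy : p = y
        · exact ⟨q, hq, fun hh => hn1 ⟨hpy, hh⟩⟩
        · exact ⟨p, hp, hpy⟩
      obtain ⟨z', hz', -, -, hs⟩ := hNo z hz hzy
      rw [ex] at hs
      have ez' := hE' z' hz'
      rcases hE z (h.mem x hx z hz) (h.ne_of_mem hz) hzy with h1 | h1 <;> rw [h1] at hs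
      · omega
      · ring_nf at hs; omega
    subst hP2
    -- Hence two core neighbours have weights 2, 2, and three have weights 1, 1, 2.
    have hsum4 : ∀ v ∈ C, ∑ u ∈ N v, e u = 4 := by
      intro v hv
      rw [h.sum_eq v hv]
      rcases hE' v hv with h1 | h1 | h1 <;> rw [h1] <;> norm_num
    have hE2 : ∀ v ∈ C, e v = 1 ∨ e v = 2 := fun v hv => by
      rcases hE' v hv with h1 | h1 | h1 <;> simp [h1]
    have hfin : ∀ v ∈ C, e v = 2 → v ≠ x → v ≠ y → (N v).card = 2 ∧ ∀ u ∈ N v, e u = 2 := by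
      intro v hv ev hvx hvy
      refine ⟨ho v hv hvx hvy, fun u hu => ?_⟩
      obtain ⟨u', hu', -, -, hs⟩ := h.other_neighbor hv (ho v hv hvx hvy) hu
      rw [ev] at hs
      have := hE2 u (h.mem v hv u hu)
      have := hE2 u' hu'
      omega
    have hu : ∀ u ∈ N x, e u = 1 → N u = {x, y} ∧ u ∈ N y := by
      intro u hu eu
      have huy : u ≠ y := by rintro rfl; omega
      obtain ⟨u', hu', hne, hNu, hs⟩ := hNo u hu huy
      rw [ex, eu] at hs
      have huu' : u ∈ N u' := h.symm u (h.mem x hx u hu) u' (by simp [hNu])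
      have : u' = y := by
        by_contra hcon
        have := (hfin u' hu' (by omega) hne hcon).2 u huu'
        omega
      subst this
      exact ⟨hNu, huu'⟩
    have main : ∀ u₁ u₂ z, u₁ ≠ u₂ → N x = {u₁, u₂, z} → e u₁ = 1 → e u₂ = 1 → e z = 2 →
      ∃ x ∈ C, ∃ y ∈ C, ∃ u₁ ∈ C, ∃ u₂ ∈ C, ∃ z ∈ C, ∃ z' ∈ C,
      x ≠ y ∧ u₁ ≠ u₂ ∧ e x = 2 ∧ e y = 2 ∧ e u₁ = 1 ∧ e u₂ = 1 ∧ e z = 2 ∧ e z' = 2 ∧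
      N x = {u₁, u₂, z} ∧ N y = {u₁, u₂, z'} ∧ N u₁ = {x, y} ∧ N u₂ = {x, y} ∧
      ∀ v ∈ C, e v = 2 → v ≠ x → v ≠ y → (N v).card = 2 ∧ ∀ u ∈ N v, e u = 2 := by
      intro u₁ u₂ z hne hNx e1 e2 ez
      have m1 : u₁ ∈ N x := by simp [hNx]
      have m2 : u₂ ∈ N x := by simp [hNx]
      have m3 : z ∈ N x := by simp [hNx]
      obtain ⟨n1, k1⟩ := hu u₁ m1 e1
      obtain ⟨n2, k2⟩ := hu u₂ m2 e2
      have hsub : ({u₁, u₂} : Finset V) ⊆ N y := by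
        intro t ht
        simp only [Finset.mem_insert, Finset.mem_singleton] at ht
        rcases ht with rfl | rfl <;> assumption
      have hcd : (N y \ {u₁, u₂}).card = 1 := by
        rw [Finset.card_sdiff_of_subset hsub, hy3, Finset.card_pair hne]
      obtain ⟨z', hz'⟩ := Finset.card_eq_one.mp hcd
      have hz'm : z' ∈ N y \ {u₁, u₂} := by simp [hz']
      have hNy : N y = {u₁, u₂, z'} := by
        rw [← Finset.union_sdiff_of_subset hsub, hz']
        ext t; simp
      have hs := hsum4 y hy
      simp only [Finset.mem_sdiff, Finset.mem_insert, Finset.mem_singleton, not_or] at hz'm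
      rw [hNy, Finset.sum_insert (by simp [hne, Ne.symm hz'm.2.1]),
        Finset.sum_pair (Ne.symm hz'm.2.2)] at hs
      exact ⟨x, hx, y, hy, u₁, h.mem x hx _ m1, u₂, h.mem x hx _ m2, z, h.mem x hx _ m3, z',
        h.mem y hy _ hz'm.1, hxy, hne, ex, ey, e1, e2, ez, by omega, hNx, hNy, n1, n2, hfin⟩
    refine ⟨rfl, rfl, ?_⟩
    by_cases e1 : e p = 1
    · by_cases e2 : e q = 1
      · exact main p q r hpq hN e1 e2 (by omega)
      · refine main p r q hpr ?_ e1 (by omega) (by omega)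
        rw [hN, Finset.pair_comm]
    · refine main q r p hqr ?_ (by omega) (by omega) (by omega)
      rw [hN, Finset.insert_comm, Finset.pair_comm]

end ParabolicCore
end Core

/-! ### Connectedness and following a chain -/

section Connectivity
variable {V : Type*} {G : SimpleGraph V}

theorem mem_of_connected_of_closed (hG : G.Connected) {S : Set V} {v₀ : V} (h0 : v₀ ∈ S)
    (hS : ∀ v ∈ S, ∀ u, G.Adj v u → u ∈ S) (v : V) : v ∈ S := by
  obtain ⟨p⟩ := hG.preconnected v₀ v
  induction p with
  | nil => exact h0
  | cons hadj _ ih => exact ih (hS _ h0 _ hadj)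

/-- An injective map between graphs that maps neighbourhoods onto neighbourhoods is an isomorphism
if the target is connected. -/
theorem nonempty_iso_of_image_neighborFinset {W : Type*} [Fintype V] [DecidableEq V] [Fintype W]
    [DecidableRel G.Adj] {G' : SimpleGraph W} [DecidableRel G'.Adj] (hG : G.Connected) (φ : W → V)
    (hφ : Function.Injective φ) (w₀ : W)
    (h : ∀ w, G.neighborFinset (φ w) = (G'.neighborFinset w).image φ) :
    ∃ ψ : G' ≃g G, ∀ w, ψ w = φ w := by
  have hsurj : Function.Surjective φ := by
    refine mem_of_connected_of_closed hG (S := Set.range φ) ⟨w₀, rfl⟩ ?_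
    rintro _ ⟨w, rfl⟩ u hu
    rw [← SimpleGraph.mem_neighborFinset, h, Finset.mem_image] at hu
    obtain ⟨w', -, rfl⟩ := hu
    exact ⟨w', rfl⟩
  have hbij : Function.Bijective φ := ⟨hφ, hsurj⟩
  refine ⟨⟨Equiv.ofBijective φ hbij, ?_⟩, fun w => rfl⟩
  intro w w'
  change G.Adj (φ w) (φ w') ↔ _
  rw [← SimpleGraph.mem_neighborFinset, h, Finset.mem_image]
  constructor
  · rintro ⟨w'', h1, h2⟩
    rw [← hφ h2]
    simpa using h1
  · intro h1
    exact ⟨w', by simpa using h1, rfl⟩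

/-- Take a longest injective `R`-walk from `x` that does not meet `y` before its end. If it did not
end at `y`, it could be extended. -/
theorem exists_chain [Fintype V] (R : V → V → Prop) (hsymm : ∀ u v, R u v → R v u) {x y z : V}
    (hxz : R x z) (hx : ∀ t, R x t → t = z) (hne : ∀ v, ¬ R v v)
    (hmid : ∀ v s, v ≠ x → v ≠ y → R v s → ∃ t, t ≠ s ∧ R v t ∧ ∀ r, R v r → r = s ∨ r = t) :
    ∃ (m : ℕ) (f : ℕ → V), f 0 = x ∧ f m = y ∧ (∀ i ≤ m, ∀ j ≤ m, f i = f j → i = j) ∧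
      ∀ i < m, R (f i) (f (i + 1)) := by
  classical
  let Q : ℕ → Prop := fun m => ∃ f : ℕ → V, f 0 = x ∧ (∀ i ≤ m, ∀ j ≤ m, f i = f j → i = j) ∧
      (∀ i < m, R (f i) (f (i + 1))) ∧ ∀ i < m, f i ≠ y
  have hQ0 : Q 0 := ⟨fun _ => x, rfl, fun i hi j hj _ => by omega, fun i hi => by omega,
    fun i hi => by omega⟩
  obtain ⟨m, ⟨f, f0, hinj, hR, hy⟩, hmax⟩ : ∃ m, Q m ∧ ¬ Q (m + 1) := by
    by_contra! hcon
    have hall : ∀ m, Q m := fun m => by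
      induction m with
      | zero => exact hQ0
      | succ n ih => exact hcon n ih
    obtain ⟨f, -, hinj, -⟩ := hall (Fintype.card V)
    have := Fintype.card_le_of_injective (fun i : Fin (Fintype.card V + 1) => f i)
      fun i j hij => Fin.ext (hinj i (by omega) j (by omega) hij)
    simp at this
  refine ⟨m, f, f0, ?_, hinj, hR⟩
  by_contra hfm
  apply hmax
  obtain ⟨t, ht, htn⟩ : ∃ t, R (f m) t ∧ ∀ i ≤ m, f i ≠ t := by
    rcases Nat.eq_zero_or_pos m with rfl | hm
    · refine ⟨z, f0 ▸ hxz, fun i hi => ?_⟩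
      rw [Nat.le_zero.mp hi, f0]
      rintro rfl
      exact hne _ hxz
    · obtain ⟨n, rfl⟩ : ∃ n, m = n + 1 := ⟨m - 1, by omega⟩
      have hmx : f (n + 1) ≠ x := by
        rw [← f0]; intro hh
        have := hinj _ le_rfl 0 (by omega) hh
        omega
      obtain ⟨t, hts, htR, -⟩ := hmid _ _ hmx hfm (hsymm _ _ (hR n (by omega)))
      -- The extension cannot return to an earlier vertex: `x` already has its only `R`-neighbour on
      -- the walk, and an interior vertex both of its own.
      refine ⟨t, htR, fun i hi hit => ?_⟩
      have hin : i ≠ n := by rintro rfl; exact hts hit.symm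
      have hin' : i ≠ n + 1 := by rintro rfl; exact hne t (hit ▸ htR)
      have htR' : R (f i) (f (n + 1)) := hit ▸ hsymm _ _ htR
      rcases Nat.eq_zero_or_pos i with rfl | hi0
      · have h1 := hx _ (f0 ▸ htR')
        have h2 := hx _ (f0 ▸ hR 0 (by omega))
        have := hinj _ le_rfl 1 (by omega) (h1.trans h2.symm)
        omega
      · obtain ⟨j, rfl⟩ : ∃ j, i = j + 1 := ⟨i - 1, by omega⟩
        have hjx : f (j + 1) ≠ x := by
          rw [← f0]; intro hh
          have := hinj _ hi 0 (by omega) hh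
          omega
        obtain ⟨t', -, -, hr⟩ := hmid _ _ hjx (hy _ (by omega)) (hsymm _ _ (hR j (by omega)))
        have hall : ∀ r, R (f (j + 1)) r → r = f j ∨ r = f (j + 2) := by
          have h1 : f (j + 2) ≠ f j := fun hh => by
            have := hinj _ (by omega) _ (by omega) hh
            omega
          have h2 := (hr _ (hR (j + 1) (by omega))).resolve_left h1
          intro r hrr
          rw [show j + 2 = j + 1 + 1 from rfl, h2]
          exact hr r hrr
        rcases hall _ htR' with hh | hh
        · have := hinj _ (by omega) _ (by omega) hh
          omega
        · have := hinj _ (by omega) _ (by omega) hh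
          omega
  refine ⟨fun i => if i ≤ m then f i else t, by simp [f0], ?_, ?_, ?_⟩
  · intro i hi j hj hij
    by_cases him : i ≤ m <;> by_cases hjm : j ≤ m
    · simp only [him, hjm, if_true] at hij; exact hinj i him j hjm hij
    · simp only [him, hjm, if_true, if_false] at hij; exact (htn i him hij).elim
    · simp only [him, hjm, if_true, if_false] at hij; exact (htn j hjm hij.symm).elim
    · omega
  · intro i hi
    have him : i ≤ m := by omega
    by_cases him' : i + 1 ≤ m
    · simp only [him, him', if_true]; exact hR i (by omega)
    · have : i = m := by omega
      subst this
      simpa using ht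
  · intro i hi
    have him : i ≤ m := by omega
    simp only [him, if_true]
    rcases him.lt_or_eq with h1 | rfl
    · exact hy i h1
    · exact hfm

end Connectivity

/-! ### From the graph to its core -/

section ToCore
variable {V : Type*} [Fintype V] (G : SimpleGraph V) [DecidableRel G.Adj]

/-- The vertices which are not pendant (in a graph without isolated vertices). -/
def core : Finset V := Finset.univ.filter fun v => 2 ≤ G.degree v

/-- The neighbours of a vertex in the core. -/
def coreNeighbors (v : V) : Finset V := (G.neighborFinset v).filter fun u => 2 ≤ G.degree u

/-- The vertex has a pendant neighbour. -/
def IsLeafy (v : V) : Prop := ∃ u, G.Adj v u ∧ G.degree u = 1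

variable {G}

theorem mem_core {v : V} : v ∈ core G ↔ 2 ≤ G.degree v := by simp [core]

theorem mem_coreNeighbors {v u : V} : u ∈ coreNeighbors G v ↔ G.Adj v u ∧ 2 ≤ G.degree u := by
  simp [coreNeighbors]

theorem eq_of_adj_of_degree_eq_one {l u v : V} (hl : G.degree l = 1) (hu : G.Adj l u)
    (hv : G.Adj l v) : u = v :=
  (SimpleGraph.degree_eq_one_iff_existsUnique_adj.mp hl).unique hu hv

theorem coreNeighbors_eq_of_not_leafy (hmin : ∀ v, 1 ≤ G.degree v) {v : V} (hl : ¬ IsLeafy G v) :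
    coreNeighbors G v = G.neighborFinset v := by
  refine Finset.filter_true_of_mem fun u hu => ?_
  have h1 := hmin u
  have h2 : G.degree u ≠ 1 := fun hh => hl ⟨u, by simpa using hu, hh⟩
  omega

theorem card_coreNeighbors_lt_of_leafy {v : V} (hl : IsLeafy G v) :
    (coreNeighbors G v).card < G.degree v := by
  obtain ⟨u, hu, hu1⟩ := hl
  rw [← SimpleGraph.card_neighborFinset_eq_degree]
  refine Finset.card_lt_card ⟨Finset.filter_subset _ _, fun hsub => ?_⟩
  have := (mem_coreNeighbors.mp (hsub (by simpa using hu))).2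
  omega

/-- A walk that enters a pendant vertex must return to where it came from, so connectedness passes
to the core. -/
theorem subset_of_core_closed (hG : G.Connected) (hmin : ∀ v, 1 ≤ G.degree v) {T : Set V} {v₀ : V}
    (h0 : v₀ ∈ T) (hT : ∀ v ∈ T, ∀ u ∈ coreNeighbors G v, u ∈ T) {v : V} (hv : v ∈ core G) :
    v ∈ T := by
  have := mem_of_connected_of_closed hG (S := {v | v ∈ T ∨ (G.degree v = 1 ∧ ∃ t ∈ T, G.Adj t v)})
    (v₀ := v₀) (Or.inl h0) (by
      rintro v (hv | ⟨hv, t, ht, htv⟩) u hu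
      · by_cases hu1 : G.degree u = 1
        · exact Or.inr ⟨hu1, v, hv, hu⟩
        · have := hmin u
          exact Or.inl (hT v hv u (mem_coreNeighbors.mpr ⟨hu, by omega⟩))
      · rw [eq_of_adj_of_degree_eq_one hv hu htv.symm]
        exact Or.inl ht) v
  rw [mem_core] at hv
  rcases this with h | h
  · exact h
  · have := h.1; omega

/-- If no two pendant vertices are adjacent, the core of a bicyclic graph is bicyclic. -/
theorem sum_card_coreNeighbors (hb : IsBicyclic G) (hmin : ∀ v, 1 ≤ G.degree v)
    (hll : ∀ l u, G.degree l = 1 → G.Adj l u → 2 ≤ G.degree u) :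
    ∑ v ∈ core G, (coreNeighbors G v).card = 2 * (core G).card + 2 := by
  set A : Finset V := Finset.univ.filter fun v => ¬ 2 ≤ G.degree v with hA
  have hA1 : ∀ v ∈ A, G.degree v = 1 := fun v hv => by
    have h1 : ¬ 2 ≤ G.degree v := by simpa [hA] using hv
    have := hmin v
    omega
  have h1 : ∑ v, G.degree v = 2 * (Fintype.card V + 1) := by
    rw [SimpleGraph.sum_degrees_eq_twice_card_edges, hb.2]
  have h2 : ∑ v ∈ core G, G.degree v + ∑ v ∈ A, G.degree v = ∑ v, G.degree v :=
    Finset.sum_filter_add_sum_filter_not _ _ _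
  have h3 : (core G).card + A.card = Fintype.card V :=
    Finset.card_filter_add_card_filter_not _
  have h4 : ∑ v ∈ A, G.degree v = A.card := by
    rw [Finset.sum_congr rfl hA1]; simp
  have h5 : ∀ v ∈ core G, G.degree v
      = (coreNeighbors G v).card + (A.filter fun u => G.Adj v u).card := by
    intro v _
    rw [← SimpleGraph.card_neighborFinset_eq_degree,
      ← Finset.card_filter_add_card_filter_not (s := G.neighborFinset v) (fun u => 2 ≤ G.degree u)]
    congr 2
    ext u
    simp [hA, and_comm]
  -- Each pendant vertex is joined to exactly one core vertex; counting these edges from both ends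
  -- gives the number of pendants.
  have h6 : ∑ v ∈ core G, (A.filter fun u => G.Adj v u).card = A.card := by
    have h7 := Finset.sum_card_bipartiteAbove_eq_sum_card_bipartiteBelow (s := core G) (t := A)
      (fun v u => G.Adj v u)
    have h8 : ∀ u ∈ A, (Finset.bipartiteBelow (fun v u => G.Adj v u) (core G) u).card = 1 := by
      intro u hu
      rw [← hA1 u hu, ← SimpleGraph.card_neighborFinset_eq_degree]
      congr 1
      ext v
      simp only [Finset.mem_bipartiteBelow, SimpleGraph.mem_neighborFinset, mem_core]
      exact ⟨fun hh => hh.2.symm, fun hh => ⟨hll u v (hA1 u hu) hh, hh.symm⟩⟩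
    rw [Finset.sum_congr rfl h8] at h7
    simpa [Finset.bipartiteAbove] using h7
  rw [Finset.sum_congr rfl h5, Finset.sum_add_distrib] at h2
  omega

variable [DecidableEq V]

/-- The core of a bicyclic graph with pendant vertices and a parabolic degree relation. -/
theorem parabolicCore_of_parabola (hb : IsBicyclic G) (hmin : G.minDegree = 1) {a b : ℤ}
    (hs : ∀ v : V, ∑ u ∈ G.neighborFinset v, (G.degree u : ℤ)
      = -(G.degree v : ℤ) ^ 2 + a * (G.degree v : ℤ) - b) :
    ParabolicCore (core G) (coreNeighbors G) (fun v => (G.degree v : ℤ) - 1) (a - b - 2) b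
      (IsLeafy G) := by
  have hd : ∀ v, 1 ≤ G.degree v := fun v => hmin ▸ G.minDegree_le_degree v
  have := hb.1.nonempty
  obtain ⟨l, hl⟩ := G.exists_minimal_degree_vertex
  rw [hmin] at hl
  set P := a - b - 2 with hP
  have hE : ∀ v, ∑ u ∈ G.neighborFinset v, ((G.degree u : ℤ) - 1)
      = (1 + ((G.degree v : ℤ) - 1)) * (P - ((G.degree v : ℤ) - 1))
        + ((G.degree v : ℤ) - 1) * b := by
    intro v
    rw [Finset.sum_sub_distrib, hs]
    simp only [Finset.sum_const, SimpleGraph.card_neighborFinset_eq_degree, nsmul_eq_mul, hP]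
    ring
  have hEc : ∀ v, ∑ u ∈ coreNeighbors G v, ((G.degree u : ℤ) - 1)
      = (1 + ((G.degree v : ℤ) - 1)) * (P - ((G.degree v : ℤ) - 1))
        + ((G.degree v : ℤ) - 1) * b := by
    intro v
    rw [← hE]
    refine Finset.sum_filter_of_ne fun u _ hu => ?_
    have := hd u
    omega
  have hleafy : ∀ l u, G.degree l = 1 → G.Adj l u → (G.degree u : ℤ) - 1 = P := by
    intro l u hl hu
    have h1 := hE l
    have h2 : G.neighborFinset l = {u} := by
      ext t
      simp only [SimpleGraph.mem_neighborFinset, Finset.mem_singleton]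
      exact ⟨fun ht => eq_of_adj_of_degree_eq_one hl ht hu, fun ht => ht ▸ hu⟩
    rw [h2, Finset.sum_singleton, hl] at h1
    rw [h1]; norm_num
  -- Otherwise a pendant vertex and its neighbour would both have degree 1 and be the whole graph, a
  -- single edge.
  have hP1 : 1 ≤ P := by
    obtain ⟨w, hw⟩ := (SimpleGraph.degree_eq_one_iff_existsUnique_adj.mp hl.symm).exists
    have h1 := hleafy l w hl.symm hw
    have h2 := hd w
    by_contra! hcon
    have hw1 : G.degree w = 1 := by omega
    have hall : ∀ v, v = l ∨ v = w := mem_of_connected_of_closed hb.1 (S := {v | v = l ∨ v = w})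
      (Or.inl rfl) (by
        rintro v (rfl | rfl) u hu
        · exact Or.inr (eq_of_adj_of_degree_eq_one hl.symm hu hw)
        · exact Or.inl (eq_of_adj_of_degree_eq_one hw1 hu hw.symm))
    have h3 : ∑ v, G.degree v = 2 * (Fintype.card V + 1) := by
      rw [SimpleGraph.sum_degrees_eq_twice_card_edges, hb.2]
    have h4 : ∀ v ∈ Finset.univ, G.degree v = 1 := by
      intro v _
      rcases hall v with rfl | rfl
      · exact hl.symm
      · exact hw1
    rw [Finset.sum_congr rfl h4] at h3
    simp at h3
    omega
  have hll : ∀ l u, G.degree l = 1 → G.Adj l u → 2 ≤ G.degree u := fun l u hl hu => by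
    have := hleafy l u hl hu
    omega
  have hsum := sum_card_coreNeighbors hb hd hll
  -- A core vertex with at most one core neighbour will force the core to have at most two vertices,
  -- against the count `2 * |core| + 2`.
  have hsmall : ¬ ∀ v ∈ core G, (coreNeighbors G v).card ≤ 1 := fun hcon => by
    have := Finset.sum_le_card_nsmul _ _ _ hcon
    rw [smul_eq_mul] at this
    omega
  have hleafyP : ∀ v, IsLeafy G v → (G.degree v : ℤ) - 1 = P := fun v ⟨u, hu, hu1⟩ =>
    hleafy u v hu1 hu.symm
  have htwo : ∀ v ∈ core G, 2 ≤ (coreNeighbors G v).card := by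
    intro v hv
    by_cases hlv : IsLeafy G v
    · by_contra! hcon
      apply hsmall
      have hev := hleafyP v hlv
      have hcard : (coreNeighbors G v).card = 0 ∨ (coreNeighbors G v).card = 1 := by omega
      rcases hcard with h0 | h1
      · intro u hu
        have : u ∈ ({v} : Set V) := subset_of_core_closed hb.1 hd (Set.mem_singleton v) (by
          rintro _ rfl t ht
          rw [Finset.card_eq_zero.mp h0] at ht
          simp at ht) hu
        rw [Set.mem_singleton_iff.mp this, h0]; norm_num
      · obtain ⟨x, hx⟩ := Finset.card_eq_one.mp h1
        have hvx : x ∈ coreNeighbors G v := by simp [hx]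
        rw [mem_coreNeighbors] at hvx
        have hxv : v ∈ coreNeighbors G x := mem_coreNeighbors.mpr ⟨hvx.1.symm, mem_core.mp hv⟩
        have hex := hEc v
        rw [hx, Finset.sum_singleton, hev] at hex
        have hex' : (G.degree x : ℤ) - 1 = P * b := by linarith
        have hb1 : 1 ≤ b := by
          by_contra! hcon
          have : P * b ≤ 0 := by nlinarith
          omega
        have hsx := hEc x
        rw [hex', ← Finset.add_sum_erase _ _ hxv, hev] at hsx
        -- The neighbour sum at `x`, of weight `P * b`, is `P` minus this product. As `v` alone
        -- contributes `P`, no further core neighbour of weight at least 1 fits.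
        have hle : P * b * ((P - 1) * (b - 1)) ≥ 0 :=
          mul_nonneg (mul_nonneg (by omega) (by omega)) (mul_nonneg (by omega) (by omega))
        have hNx : (coreNeighbors G x).erase v = ∅ := by
          by_contra hne
          obtain ⟨t, ht⟩ := Finset.nonempty_iff_ne_empty.mpr hne
          have h2 : (G.degree t : ℤ) - 1
              ≤ ∑ u ∈ (coreNeighbors G x).erase v, ((G.degree u : ℤ) - 1) :=
            Finset.single_le_sum (f := fun u => (G.degree u : ℤ) - 1) (fun u _ => by
              have := hd u
              omega) ht
          have h3 := (mem_coreNeighbors.mp (Finset.mem_erase.mp ht).2).2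
          have h4 : (1 + P * b) * (P - P * b) + P * b * b
              = P - P * b * ((P - 1) * (b - 1)) := by ring
          omega
        have hNx' : coreNeighbors G x = {v} := by
          rw [← Finset.insert_erase hxv, hNx]
          simp
        intro u hu
        have : u ∈ ({v, x} : Set V) := subset_of_core_closed hb.1 hd (v₀ := v) (by simp) (by
          rintro s (rfl | rfl) t ht
          · rw [hx] at ht
            simp at ht; simp [ht]
          · rw [hNx'] at ht
            simp at ht; simp [ht]) hu
        rcases this with rfl | rfl
        · exact h1.le
        · rw [hNx']; simp
    · rw [coreNeighbors_eq_of_not_leafy hd hlv, SimpleGraph.card_neighborFinset_eq_degree]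
      exact mem_core.mp hv
  refine
    { mem := fun v _ u hu => mem_core.mpr (mem_coreNeighbors.mp hu).2
      symm := fun v hv u hu =>
        mem_coreNeighbors.mpr ⟨(mem_coreNeighbors.mp hu).1.symm, mem_core.mp hv⟩
      irrefl := fun v hv => G.loopless.irrefl v (mem_coreNeighbors.mp hv).1
      sum_eq := fun v _ => hEc v
      two_le := htwo
      total := ?_
      weight_leafy := fun v _ hl => ⟨hleafyP v hl, ?_⟩
      weight_nonleafy := fun v _ hl => ?_
      exists_leafy := ?_ }
  · have h1 : ∑ v ∈ core G, (((coreNeighbors G v).card - 2) + 2)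
        = ∑ v ∈ core G, (coreNeighbors G v).card :=
      Finset.sum_congr rfl fun v hv => Nat.sub_add_cancel (htwo v hv)
    rw [Finset.sum_add_distrib, hsum, Finset.sum_const, smul_eq_mul] at h1
    omega
  · have h1 := card_coreNeighbors_lt_of_leafy hl
    have h2 := hleafyP v hl
    omega
  · rw [coreNeighbors_eq_of_not_leafy hd hl, SimpleGraph.card_neighborFinset_eq_degree]
  · obtain ⟨w, hw⟩ := (SimpleGraph.degree_eq_one_iff_existsUnique_adj.mp hl.symm).exists
    exact ⟨w, mem_core.mpr (hll l w hl.symm hw), l, hw.symm, hl.symm⟩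

end ToCore
-- Recognising `H k`
section Iso
open HVertex
variable {V : Type*} [Fintype V] [DecidableEq V] {G : SimpleGraph V} [DecidableRel G.Adj]

/-- The images of the vertices of `H k` for a given path, pair of side vertices and choice of
pendant neighbours. -/
def hMap (k : ℕ) (f : ℕ → V) (u₁ u₂ : V) (g : V → V) : HVertex k → V
  | .path i => f i
  | .side j => if j = 0 then u₁ else u₂
  | .pendant i => g (f (i + 1))

/-- Recognition of `H k` from the neighbourhoods along its path. -/
theorem exists_iso_H (hG : G.Connected) (k : ℕ) {f : ℕ → V} {u₁ u₂ : V} {g : V → V}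
    (hu : u₁ ≠ u₂) (hinj : ∀ i ≤ k + 1, ∀ j ≤ k + 1, f i = f j → i = j)
    (h0 : G.neighborFinset (f 0) = {u₁, u₂, f 1})
    (hlast : G.neighborFinset (f (k + 1)) = {u₁, u₂, f k})
    (hmid : ∀ i < k, G.neighborFinset (f (i + 1)) = {f i, f (i + 2), g (f (i + 1))})
    (hu₁ : G.neighborFinset u₁ = {f 0, f (k + 1)}) (hu₂ : G.neighborFinset u₂ = {f 0, f (k + 1)})
    (hg : ∀ i < k, G.neighborFinset (g (f (i + 1))) = {f (i + 1)})
    (hdf : ∀ i ≤ k + 1, G.degree (f i) = 3) :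
    ∃ ψ : H k ≃g G, ∀ w, ψ w = hMap k f u₁ u₂ g w := by
  have hf0 : f 0 ≠ f (k + 1) := fun hh => by
    have := hinj _ (by omega) _ le_rfl hh
    omega
  have hd1 : G.degree u₁ = 2 := by
    rw [← SimpleGraph.card_neighborFinset_eq_degree, hu₁, Finset.card_pair hf0]
  have hd2 : G.degree u₂ = 2 := by
    rw [← SimpleGraph.card_neighborFinset_eq_degree, hu₂, Finset.card_pair hf0]
  have hdg : ∀ i < k, G.degree (g (f (i + 1))) = 1 := fun i hi => by
    rw [← SimpleGraph.card_neighborFinset_eq_degree, hg i hi, Finset.card_singleton]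
  have hside : ∀ j, hMap k f u₁ u₂ g (side j) = u₁ ∨ hMap k f u₁ u₂ g (side j) = u₂ := fun j =>
    ite_eq_or_eq _ _ _
  have hdeg : ∀ w, G.degree (hMap k f u₁ u₂ g w) = (H k).degree w := by
    rintro (i | j | i)
    · rw [H_degree_path]; exact hdf i (by omega)
    · rw [H_degree_side]
      rcases hside j with h1 | h1 <;> rw [h1] <;> assumption
    · rw [H_degree_pendant]; exact hdg i i.2
  refine nonempty_iso_of_image_neighborFinset hG _ ?_ (path 0) ?_
  -- Degrees 3, 2, 1 separate the three kinds of vertices; two pendants with the same image have the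
  -- same unique neighbour.
  · intro w w' hww
    have hdd : (H k).degree w = (H k).degree w' := by rw [← hdeg, ← hdeg, hww]
    rcases w with i | i | i <;> rcases w' with j | j | j <;>
      simp only [H_degree_path, H_degree_side, H_degree_pendant] at hdd <;>
      first | omega | skip
    · have := hinj i (by omega) j (by omega) hww
      rw [Fin.ext this]
    · simp only [hMap] at hww
      congr 1
      split_ifs at hww with h1 h2 h2
      · rw [h1, h2]
      · exact (hu hww).elim
      · exact (hu hww.symm).elim
      · omega
    · have h1 : ({f (i + 1)} : Finset V) = {f (j + 1)} := by
        rw [← hg i i.2, ← hg j j.2]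
        simp only [hMap] at hww
        rw [hww]
      have := hinj _ (by omega) _ (by omega) (Finset.singleton_injective h1)
      congr 1
      ext
      omega
  · rintro (i | j | i)
    · rcases fin_path_cases i with rfl | rfl | ⟨j, rfl⟩
      · rw [H_neighborFinset_path_zero]
        rw [show hMap k f u₁ u₂ g (path 0) = f 0 from rfl, h0]
        simp [Finset.image_insert, hMap]
      · rw [H_neighborFinset_path_last]
        rw [show hMap k f u₁ u₂ g (path (Fin.last (k + 1))) = f (k + 1) from rfl, hlast]
        simp [Finset.image_insert, hMap]
      · rw [H_neighborFinset_path_interior]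
        rw [show hMap k f u₁ u₂ g (path j.succ.castSucc) = f (j + 1) from rfl, hmid j j.2]
        simp [Finset.image_insert, hMap]
    · rw [H_neighborFinset_side]
      have himg : ({path 0, path (Fin.last (k + 1))} : Finset (HVertex k)).image (hMap k f u₁ u₂ g)
          = {f 0, f (k + 1)} := by
        simp [Finset.image_insert, hMap]
      rw [himg]
      rcases hside j with h1 | h1 <;> rw [h1] <;> assumption
    · rw [H_neighborFinset_pendant]
      rw [show hMap k f u₁ u₂ g (pendant i) = g (f (i + 1)) from rfl, hg i i.2]
      simp [hMap]

/-- A bicyclic graph with a pendant vertex satisfying a parabolic degree relation is some `H k`. -/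
theorem exists_iso_H_of_parabola (hb : IsBicyclic G) (hmin : G.minDegree = 1) {a b : ℤ}
    (hs : ∀ v : V, ∑ u ∈ G.neighborFinset v, (G.degree u : ℤ)
      = -(G.degree v : ℤ) ^ 2 + a * (G.degree v : ℤ) - b) :
    ∃ k : ℕ, 1 ≤ k ∧ Nonempty (G ≃g H k) := by
  classical
  have hd : ∀ v, 1 ≤ G.degree v := fun v => hmin ▸ G.minDegree_le_degree v
  have hcore := parabolicCore_of_parabola hb hmin hs
  obtain ⟨hP, hb2, x, hx, y, hy, u₁, hu₁, u₂, hu₂, z, hz, z', hz', hxy, hu12, ex, ey, e1, e2, ez,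
    ez', hNx, hNy, hN1, hN2, hrest⟩ := hcore.classification
  have hfull : ∀ v, (coreNeighbors G v).card = G.degree v →
      G.neighborFinset v = coreNeighbors G v := fun v hv =>
    (Finset.eq_of_subset_of_card_le (Finset.filter_subset _ _) (by
      rw [SimpleGraph.card_neighborFinset_eq_degree]; exact hv.ge)).symm
  have hu1z : u₁ ≠ z := by rintro rfl; omega
  have hu2z : u₂ ≠ z := by rintro rfl; omega
  have hu1z' : u₁ ≠ z' := by rintro rfl; omega
  have hu2z' : u₂ ≠ z' := by rintro rfl; omega
  have hGx : G.neighborFinset x = {u₁, u₂, z} := by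
    rw [hfull x, hNx]
    rw [hNx, Finset.card_eq_three.mpr ⟨_, _, _, hu12, hu1z, hu2z, rfl⟩]; omega
  have hGy : G.neighborFinset y = {u₁, u₂, z'} := by
    rw [hfull y, hNy]
    rw [hNy, Finset.card_eq_three.mpr ⟨_, _, _, hu12, hu1z', hu2z', rfl⟩]; omega
  have hG1 : G.neighborFinset u₁ = {x, y} := by
    rw [hfull u₁, hN1]
    rw [hN1, Finset.card_pair hxy]; omega
  have hG2 : G.neighborFinset u₂ = {x, y} := by
    rw [hfull u₂, hN2]
    rw [hN2, Finset.card_pair hxy]; omega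
  -- Adjacency among vertices of degree 3, that is of weight 2. Under `R`, `x` has the single
  -- neighbour `z`, and any vertex other than `x`, `y` with an `R`-neighbour has exactly two.
  let R : V → V → Prop := fun u v => G.Adj u v ∧ G.degree u = 3 ∧ G.degree v = 3
  have hRx : ∀ t, R x t → t = z := by
    rintro t ⟨ht, -, ht3⟩
    rw [← SimpleGraph.mem_neighborFinset, hGx] at ht
    simp only [Finset.mem_insert, Finset.mem_singleton] at ht
    rcases ht with rfl | rfl | rfl
    · omega
    · omega
    · rfl
  have hRy : ∀ t, R y t → t = z' := by
    rintro t ⟨ht, -, ht3⟩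
    rw [← SimpleGraph.mem_neighborFinset, hGy] at ht
    simp only [Finset.mem_insert, Finset.mem_singleton] at ht
    rcases ht with rfl | rfl | rfl
    · omega
    · omega
    · rfl
  have hRN : ∀ v s, R v s → s ∈ coreNeighbors G v := fun v s hvs =>
    mem_coreNeighbors.mpr ⟨hvs.1, by have := hvs.2.2; omega⟩
  have hRv : ∀ v s, v ≠ x → v ≠ y → R v s → ∃ t, t ≠ s ∧ R v t ∧ coreNeighbors G v = {s, t} := by
    intro v s hvx hvy hvs
    obtain ⟨hc, hall⟩ := hrest v (mem_core.mpr (by have := hvs.2.1; omega))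
      (by have := hvs.2.1; omega) hvx hvy
    have hsm := hRN v s hvs
    obtain ⟨t, ht⟩ := Finset.card_eq_one.mp
      (show ((coreNeighbors G v).erase s).card = 1 by rw [Finset.card_erase_of_mem hsm, hc])
    have htm : t ∈ (coreNeighbors G v).erase s := by simp [ht]
    rw [Finset.mem_erase] at htm
    refine ⟨t, htm.1, ⟨(mem_coreNeighbors.mp htm.2).1, hvs.2.1, ?_⟩, ?_⟩
    · have := hall t htm.2; omega
    · rw [← Finset.insert_erase hsm, ht]
  have hRsymm : ∀ u v, R u v → R v u := fun u v huv => ⟨huv.1.symm, huv.2.2, huv.2.1⟩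
  obtain ⟨m, f, hf0, hfm, hinj, hR⟩ := exists_chain (y := y) R hRsymm
    (show R x z from ⟨by rw [← SimpleGraph.mem_neighborFinset, hGx]; simp, by omega, by omega⟩)
    hRx (fun v hv => G.loopless.irrefl v hv.1) (fun v s hvx hvy hvs => by
      obtain ⟨t, hts, hvt, hN⟩ := hRv v s hvx hvy hvs
      refine ⟨t, hts, hvt, fun r hr => ?_⟩
      have := hRN v r hr
      rw [hN] at this
      simpa using this)
  obtain ⟨k, rfl⟩ : ∃ k, m = k + 1 := by
    cases m with
    | zero => exact (hxy (hf0.symm.trans hfm)).elim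
    | succ k => exact ⟨k, rfl⟩
  have hdf : ∀ i ≤ k + 1, G.degree (f i) = 3 := by
    intro i hi
    rcases Nat.lt_or_eq_of_le hi with h1 | rfl
    · exact (hR i h1).2.1
    · exact (hR k (by omega)).2.2
  have hleaf : ∀ i < k, ∃ l, G.degree l = 1 ∧
      G.neighborFinset (f (i + 1)) = {f i, f (i + 2), l} := by
    intro i hi
    have hvx : f (i + 1) ≠ x := by
      rw [← hf0]; intro hh
      have := hinj _ (by omega) 0 (by omega) hh
      omega
    have hvy : f (i + 1) ≠ y := by
      rw [← hfm]; intro hh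
      have := hinj _ (by omega) (k + 1) (by omega) hh
      omega
    obtain ⟨t, hts, hvt, hN⟩ := hRv _ _ hvx hvy (hRsymm _ _ (hR i (by omega)))
    have htf : t = f (i + 2) := by
      have := hRN _ _ (hR (i + 1) (by omega))
      rw [hN] at this
      simp only [Finset.mem_insert, Finset.mem_singleton] at this
      rcases this with h1 | h1
      · have := hinj _ (by omega) _ (by omega) h1
        omega
      · exact h1.symm
    subst htf
    have hsub : coreNeighbors G (f (i + 1)) ⊆ G.neighborFinset (f (i + 1)) :=
      Finset.filter_subset _ _
    obtain ⟨l, hl⟩ := Finset.card_eq_one.mp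
      (show (G.neighborFinset (f (i + 1)) \ coreNeighbors G (f (i + 1))).card = 1 by
        rw [Finset.card_sdiff_of_subset hsub, SimpleGraph.card_neighborFinset_eq_degree,
          hdf _ (by omega), hN, Finset.card_pair hts.symm])
    have hlm : l ∈ G.neighborFinset (f (i + 1)) \ coreNeighbors G (f (i + 1)) := by simp [hl]
    refine ⟨l, ?_, ?_⟩
    · rw [Finset.mem_sdiff, SimpleGraph.mem_neighborFinset, mem_coreNeighbors] at hlm
      have h1 := hd l
      have h2 : ¬ 2 ≤ G.degree l := fun hh => hlm.2 ⟨hlm.1, hh⟩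
      omega
    · rw [← Finset.union_sdiff_of_subset hsub, hl, hN]
      ext t; simp
  -- The value `v` at vertices without a pendant neighbour is never used.
  let g : V → V := fun v => if hv : ∃ l, G.Adj v l ∧ G.degree l = 1 then hv.choose else v
  have hg : ∀ v l, G.Adj v l → G.degree l = 1 → G.Adj v (g v) ∧ G.degree (g v) = 1 := by
    intro v l hvl hl
    have hv : ∃ l, G.Adj v l ∧ G.degree l = 1 := ⟨l, hvl, hl⟩
    have hgv : g v = hv.choose := dif_pos hv
    rw [hgv]
    exact hv.choose_spec
  have hgf : ∀ i < k, G.degree (g (f (i + 1))) = 1 ∧ G.Adj (f (i + 1)) (g (f (i + 1))) ∧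
      G.neighborFinset (f (i + 1)) = {f i, f (i + 2), g (f (i + 1))} := by
    intro i hi
    obtain ⟨l, hl, hN⟩ := hleaf i hi
    have hadj : G.Adj (f (i + 1)) l := by
      rw [← SimpleGraph.mem_neighborFinset, hN]; simp
    obtain ⟨h1, h2⟩ := hg _ _ hadj hl
    have h3 : g (f (i + 1)) = l := by
      have h4 := h1
      rw [← SimpleGraph.mem_neighborFinset, hN] at h4
      simp only [Finset.mem_insert, Finset.mem_singleton] at h4
      rcases h4 with h4 | h4 | h4
      · have := hdf i (by omega)
        rw [h4] at h2; omega
      · have := hdf (i + 2) (by omega)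
        rw [h4] at h2; omega
      · exact h4
    exact ⟨h2, h1, h3 ▸ hN⟩
  obtain ⟨ψ, hψ⟩ := exists_iso_H hb.1 k (g := g) hu12 hinj
    (by rw [hf0, hGx, hRx (f 1) (hf0 ▸ hR 0 (by omega))])
    (by rw [hfm, hGy, hRy (f k) (hfm ▸ hRsymm _ _ (hR k (by omega)))])
    (fun i hi => (hgf i hi).2.2) (by rw [hG1, hf0, hfm]) (by rw [hG2, hf0, hfm])
    (fun i hi => by
      obtain ⟨h1, h2, -⟩ := hgf i hi
      ext t
      rw [SimpleGraph.mem_neighborFinset, Finset.mem_singleton]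
      exact ⟨fun ht => eq_of_adj_of_degree_eq_one h1 ht h2.symm, fun ht => ht ▸ h2.symm⟩)
    hdf
  refine ⟨k, ?_, ⟨ψ.symm⟩⟩
  -- A vertex of degree 1 corresponds to a pendant vertex of `H k`, whose index in `Fin k` shows
  -- that `k` is positive.
  have := hb.1.nonempty
  obtain ⟨l, hl⟩ := G.exists_minimal_degree_vertex
  rw [hmin, ← ψ.symm.degree_eq] at hl
  rcases hw : ψ.symm l with i | i | i
  · rw [hw, H_degree_path] at hl; omega
  · rw [hw, H_degree_side] at hl; omega
  · have := i.2; omega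

end Iso

/-- If all degrees were 1, the degree sum `n` would equal `2(n + 1)`. -/
theorem exists_degree_ne {V : Type*} [Fintype V] {G : SimpleGraph V} [DecidableRel G.Adj]
    (hb : IsBicyclic G) (hmin : G.minDegree = 1) :
    ∃ v₀ v₁ : V, G.degree v₀ ≠ G.degree v₁ := by
  have := hb.1.nonempty
  obtain ⟨l, hl⟩ := G.exists_minimal_degree_vertex
  rw [hmin] at hl
  by_contra! hcon
  have h3 : ∑ v, G.degree v = 2 * (Fintype.card V + 1) := by
    rw [SimpleGraph.sum_degrees_eq_twice_card_edges, hb.2]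
  rw [Finset.sum_congr rfl fun v _ => (hcon v l).trans hl.symm] at h3
  simp at h3
  omega

end Bicyclic

theorem theorem1 :
    (∀ (V : Type*) [Fintype V] [DecidableEq V] (G : SimpleGraph V) [DecidableRel G.Adj],
      Bicyclic.IsBicyclic G → G.minDegree = 1 →
        (Bicyclic.HasExactlyTwoMainEigenvalues G ↔
          ∃ k : ℕ, 1 ≤ k ∧ Nonempty (G ≃g Bicyclic.H k))) ∧
    (∀ k : ℕ, 1 ≤ k → Bicyclic.IsTwoWalkParabolic (Bicyclic.H k) 6 2) := by
  refine ⟨fun V _ _ G _ hb hmin => ⟨fun h => ?_, ?_⟩, fun k hk => Bicyclic.H_isTwoWalkParabolic hk⟩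
  · obtain ⟨v₀, v₁, hne⟩ := Bicyclic.exists_degree_ne hb hmin
    obtain ⟨a, b, hab⟩ := Bicyclic.exists_int_parabola G h hne
    exact Bicyclic.exists_iso_H_of_parabola hb hmin hab
  · rintro ⟨k, -, ⟨φ⟩⟩
    exact Bicyclic.hasExactlyTwoMainEigenvalues_of_iso_H G φ
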